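/- Let $K$ be a number field and $n\ge 1$. We consider two cases: (a) $K$ is embedded in $\mathbb R$, $G=\mathbb R$ and $q=1$; (b) $K$ is embedded in $\mathbb C$ by a non-real embedding, $G=\mathbb C$ and $q=2$. Equip $G^{n+1}$ with its canonical inner product and $\bigwedge^d(G^{n+1})$ (and likewise $\bigwedge^d(\mathbb C^{n+1})$) with the inner product for which the products $e_{i_1}\wedge\dots\wedge e_{i_d}$ ($i_1<\dots<i_d$) of standard basis vectors are orthonormal. Height. For a $d$-dimensional subspace $T$ of $K^{n+1}$ with basis $X_1,\dots,X_d$, put $$H(T)=N(\mathfrak a)^{-1}\prod_{\varphi:K\hookrightarrow\mathbb C}\|\varphi X_1\wedge\dots\wedge\varphi X_d\|,$$ where $\varphi$ is applied coordinatewise and $N(\mathfrak a)$ is the norm of the fractional ideal $\mathfrak a$ generated by the $d\times d$ minors of the matrix with rows $X_1,\dots,X_d$; this does not depend on the basis. A subspace $S$ of $G^{n+1}$ is defined over $K$ if it is spanned by vectors with coordinates in $K$, and then $H(S):=H(S\cap K^{n+1})$. Distance. For nonzero $X,Y\in G^{n+1}$ put $\operatorname{dist}(X,Y)=\|X\wedge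 Y\|/(\|X\|\,\|Y\|)$; for a nonzero subspace $B$ put $\operatorname{dist}(X,B)=\inf_{Y\in B\setminus\{0\}}\operatorname{dist}(X,Y)$. For nonzero subspaces $A,B$ put $\omega_1(A,B)=\inf_F\sup_{X\in F\setminus\{0\}}\operatorname{dist}(X,B)$, where $F$ runs over the one-dimensional subspaces of $A$. For $u\in G^{n+1}\setminus\{0\}$ put $\omega_1(u,B)=\omega_1(\operatorname{Span}(u),B)$. Exponents. For $u\in G^{n+1}\setminus\{0\}$ and $0\le j\le n-1$ let $\omega_{j,K}(u)\in[-\infty,\infty]$ (resp. $\hat\omega_{j,K}(u)$) be the supremum of all real numbers $\omega$ such that, for arbitrarily large real $Q$ (resp. for all sufficiently large real $Q$), there is a subspace $S$ of $G^{n+1}$, defined over $K$, of dimension $j+1$, with $$H(S)\le Q\quad\text{and}\quad H(S)\,\omega_1(u,S)^q\le Q^{-\omega}.$$ Theorem. In both cases (a) and (b), for every $u\in G^{n+1}\setminus\{0\}$ and every integer $j$ with $0\le j\le n-1$, $$\omega_{j,K}(u)\ \ge\ \hat\omega_{j,K}(u)\ \ge\ \frac{j+1}{n-j}.$$ -/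

import Mathlib

open scoped NumberField
open Filter

noncomputable section

namespace SchmidtApprox

/-! ### Exterior products -/

/-- The coordinate of `X₁ ∧ ⋯ ∧ X_d ∈ ⋀^d (R^m)` at `e_{i₁} ∧ ⋯ ∧ e_{i_d}`, where
`s = {i₁ < ⋯ < i_d}` and `e` is the standard basis of `R^m`. -/
def wedgeCoord {R : Type*} [CommRing R] {d m : ℕ} (X : Fin d → Fin m → R)
    (s : Set.powersetCard (Fin m) d) : R :=
  ((Pi.basisFun R (Fin m)).exteriorPower d).repr (exteriorPower.ιMulti R d X) s

/-- The coordinates of `X₁ ∧ ⋯ ∧ X_d` are the `d × d` minors of the matrix with rows `X_i`. -/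
theorem wedgeCoord_eq_det {R : Type*} [CommRing R] {d m : ℕ} (X : Fin d → Fin m → R)
    (s : Set.powersetCard (Fin m) d) :
    wedgeCoord X s =
      ((Matrix.of X).submatrix id (Set.powersetCard.ofFinEmbEquiv.symm s)).det := by
  rw [wedgeCoord, exteriorPower.basis_repr_apply, exteriorPower.ιMultiDual_apply_ιMulti]
  rfl

/-- `‖X₁ ∧ ⋯ ∧ X_d‖` for vectors of `𝕜^m`, in the inner product on `⋀^d (𝕜^m)` for which the
products `e_{i₁} ∧ ⋯ ∧ e_{i_d}` with `i₁ < ⋯ < i_d` are orthonormal. -/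
def wedgeNorm {𝕜 : Type*} [RCLike 𝕜] {d m : ℕ} (X : Fin d → Fin m → 𝕜) : ℝ :=
  √(∑ s : Set.powersetCard (Fin m) d, ‖wedgeCoord X s‖ ^ 2)

/-! ### Height of a subspace of `K^m` -/

section Height

variable {K : Type*} [Field K] [NumberField K] {d m : ℕ}

/-- The fractional ideal of `K` generated by the `d × d` minors of the matrix with
rows `X₁, …, X_d`. -/
def minorIdeal (X : Fin d → Fin m → K) : FractionalIdeal (nonZeroDivisors (𝓞 K)) K :=
  FractionalIdeal.spanFinset (𝓞 K) Finset.univ (wedgeCoord X)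

/-- `N(𝔞)⁻¹ ∏_φ ‖φ X₁ ∧ ⋯ ∧ φ X_d‖`, the product being over all embeddings `φ : K → ℂ`. -/
def heightOfFamily (X : Fin d → Fin m → K) : ℝ :=
  ((FractionalIdeal.absNorm (minorIdeal X) : ℚ) : ℝ)⁻¹ *
    ∏ φ : K →+* ℂ, wedgeNorm (fun i k => φ (X i k))

/-- The height of a subspace of `K^m`, computed from a basis of it; the choice of the basis
is immaterial by `height_eq_heightOfFamily` below. -/
def height (T : Submodule K (Fin m → K)) : ℝ :=
  heightOfFamily (fun i => ((Module.finBasis K T i : T) : Fin m → K))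

end Height

/-! ### Distance between subspaces of `𝕜^m` -/

section Distance

variable {𝕜 : Type*} [RCLike 𝕜] {m : ℕ}

/-- The projective distance `‖X ∧ Y‖ / (‖X‖ ‖Y‖)` of two nonzero vectors. -/
def projDist (X Y : EuclideanSpace 𝕜 (Fin m)) : ℝ :=
  wedgeNorm ![X.ofLp, Y.ofLp] / (‖X‖ * ‖Y‖)

/-- The distance of a nonzero vector to a nonzero subspace. -/
def distToSubspace (X : EuclideanSpace 𝕜 (Fin m))
    (B : Submodule 𝕜 (EuclideanSpace 𝕜 (Fin m))) : ℝ :=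
  ⨅ Y : {Y : EuclideanSpace 𝕜 (Fin m) // Y ∈ B ∧ Y ≠ 0}, projDist X Y.1

/-- `ω_i(A, B)`: the infimum over the `i`-dimensional subspaces `F` of `A` of the supremum
over the nonzero `X ∈ F` of the distance of `X` to `B`. -/
def omegaI (i : ℕ) (A B : Submodule 𝕜 (EuclideanSpace 𝕜 (Fin m))) : ℝ :=
  ⨅ F : {F : Submodule 𝕜 (EuclideanSpace 𝕜 (Fin m)) // F ≤ A ∧ Module.finrank 𝕜 F = i},
    ⨆ X : {X : EuclideanSpace 𝕜 (Fin m) // X ∈ F.1 ∧ X ≠ 0}, distToSubspace X.1 B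

end Distance

/-! ### Subspaces defined over `K` and the exponents -/

section Exponents

variable {K : Type*} [Field K] [NumberField K] {𝕜 : Type*} [RCLike 𝕜] (σ : K →+* 𝕜) {m : ℕ}

/-- The inclusion `K^m → 𝕜^m` given by an embedding `σ : K → 𝕜`. -/
def embedVec (x : Fin m → K) : EuclideanSpace 𝕜 (Fin m) :=
  WithLp.toLp 2 (fun k => σ (x k))

/-- `S` is defined over `K`: it is spanned by vectors with coordinates in `K`. -/
def IsDefinedOver (S : Submodule 𝕜 (EuclideanSpace 𝕜 (Fin m))) : Prop :=
  ∃ B : Set (Fin m → K), Submodule.span 𝕜 (embedVec σ '' B) = S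

/-- `S ∩ K^m`, as a subspace of `K^m`. -/
def rationalPoints (S : Submodule 𝕜 (EuclideanSpace 𝕜 (Fin m))) : Submodule K (Fin m → K) where
  carrier := {x | embedVec σ x ∈ S}
  zero_mem' := by
    have h : embedVec σ (0 : Fin m → K) = 0 := by ext k; simp [embedVec]
    simp [h]
  add_mem' := by
    intro x y hx hy
    have h : embedVec σ (x + y) = embedVec σ x + embedVec σ y := by ext k; simp [embedVec]
    rw [Set.mem_ofPred_eq, h]
    exact S.add_mem hx hy
  smul_mem' := by
    intro c x hx
    have h : embedVec σ (c • x) = σ c • embedVec σ x := by ext k; simp [embedVec]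
    rw [Set.mem_ofPred_eq, h]
    exact S.smul_mem _ hx

/-- The height of a subspace of `𝕜^m` defined over `K`: the height of `S ∩ K^m`. -/
def heightOver (S : Submodule 𝕜 (EuclideanSpace 𝕜 (Fin m))) : ℝ :=
  height (rationalPoints σ S)

/-- There is a subspace `S` defined over `K`, of dimension `j + 1`, with `H(S) ≤ Q` and
`H(S) ω₁(u, S)^q ≤ Q^(-w)`. -/
def HasApprox (q j : ℕ) (u : EuclideanSpace 𝕜 (Fin m)) (w Q : ℝ) : Prop :=
  ∃ S : Submodule 𝕜 (EuclideanSpace 𝕜 (Fin m)),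
    IsDefinedOver σ S ∧ Module.finrank 𝕜 S = j + 1 ∧ heightOver σ S ≤ Q ∧
      heightOver σ S * omegaI 1 (Submodule.span 𝕜 {u}) S ^ q ≤ Q ^ (-w)

/-- The exponent `ω_{j,K}(u) ∈ [-∞, ∞]`: the supremum of the real `w` for which approximating
subspaces exist for arbitrarily large real `Q`. -/
def ordExponent (q j : ℕ) (u : EuclideanSpace 𝕜 (Fin m)) : EReal :=
  sSup ((fun w : ℝ => (w : EReal)) '' {w : ℝ | ∃ᶠ Q : ℝ in atTop, HasApprox σ q j u w Q})

/-- The exponent `ω̂_{j,K}(u) ∈ [-∞, ∞]`: the supremum of the real `w` for which approximating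
subspaces exist for all sufficiently large real `Q`. -/
def unifExponent (q j : ℕ) (u : EuclideanSpace 𝕜 (Fin m)) : EReal :=
  sSup ((fun w : ℝ => (w : EReal)) '' {w : ℝ | ∀ᶠ Q : ℝ in atTop, HasApprox σ q j u w Q})

end Exponents

/-! ### The height does not depend on the basis -/

section HeightWellDefined

variable {d m : ℕ}

theorem wedgeCoord_mul {R : Type*} [CommRing R] (A : Matrix (Fin d) (Fin d) R)
    (X : Fin d → Fin m → R) (s : Set.powersetCard (Fin m) d) :
    wedgeCoord (fun i => ∑ l, A i l • X l) s = A.det * wedgeCoord X s := by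
  rw [wedgeCoord_eq_det, wedgeCoord_eq_det, ← Matrix.det_mul]
  congr 1
  ext i k
  simp [Matrix.mul_apply, Finset.sum_apply]

theorem wedgeNorm_mul {𝕜 : Type*} [RCLike 𝕜] (A : Matrix (Fin d) (Fin d) 𝕜)
    (X : Fin d → Fin m → 𝕜) :
    wedgeNorm (fun i => ∑ l, A i l • X l) = ‖A.det‖ * wedgeNorm X := by
  simp only [wedgeNorm, wedgeCoord_mul, norm_mul, mul_pow, ← Finset.mul_sum]
  rw [Real.sqrt_mul (by positivity), Real.sqrt_sq (norm_nonneg _)]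

variable {K : Type*} [Field K] [NumberField K]

theorem minorIdeal_mul (A : Matrix (Fin d) (Fin d) K) (X : Fin d → Fin m → K) :
    minorIdeal (fun i => ∑ l, A i l • X l) =
      FractionalIdeal.spanSingleton (nonZeroDivisors (𝓞 K)) A.det * minorIdeal X := by
  apply FractionalIdeal.coeToSubmodule_injective
  beta_reduce
  rw [FractionalIdeal.coe_mul, FractionalIdeal.coe_spanSingleton, minorIdeal, minorIdeal,
    FractionalIdeal.spanFinset_coe, FractionalIdeal.spanFinset_coe, Submodule.span_mul_span]
  congr 1
  ext x
  simp [wedgeCoord_mul]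

theorem heightOfFamily_mul (A : Matrix (Fin d) (Fin d) K) (hA : A.det ≠ 0)
    (X : Fin d → Fin m → K) :
    heightOfFamily (fun i => ∑ l, A i l • X l) = heightOfFamily X := by
  have h1 : ∀ φ : K →+* ℂ, wedgeNorm (fun i k => φ ((∑ l, A i l • X l) k)) =
      ‖φ A.det‖ * wedgeNorm (fun i k => φ (X i k)) := by
    intro φ
    have h := wedgeNorm_mul (φ.mapMatrix A) (fun i k => φ (X i k))
    rw [← RingHom.map_det] at h
    rw [← h]
    congr 1
    ext i k
    simp [Finset.sum_apply]
  have h2 : ∏ φ : K →+* ℂ, ‖φ A.det‖ = ((|Algebra.norm ℚ A.det| : ℚ) : ℝ) := by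
    have h := Algebra.norm_eq_prod_embeddings ℚ ℂ A.det
    have h3 : ∏ φ : K →+* ℂ, ‖φ A.det‖ = ∏ φ : K →ₐ[ℚ] ℂ, ‖φ A.det‖ :=
      Fintype.prod_equiv (RingHom.equivRatAlgHom K ℂ) _ _ (fun _ => rfl)
    rw [h3, ← norm_prod, ← h]
    simp
  have h4 : ((|Algebra.norm ℚ A.det| : ℚ) : ℝ) ≠ 0 := by
    simpa [Algebra.norm_eq_zero_iff] using hA
  simp only [heightOfFamily, minorIdeal_mul, map_mul, FractionalIdeal.absNorm_span_singleton, h1,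
    Finset.prod_mul_distrib, h2, Rat.cast_mul, mul_inv]
  field_simp

/-- The height of `T` may be computed from any basis of `T`. -/
theorem height_eq_heightOfFamily (T : Submodule K (Fin m → K)) (b : Module.Basis (Fin d) K T) :
    height T = heightOfFamily (fun i => ((b i : T) : Fin m → K)) := by
  obtain rfl : d = Module.finrank K T := by simp [Module.finrank_eq_card_basis b]
  set c := Module.finBasis K T
  have hA : (c.toMatrix b).det ≠ 0 := by
    have h := congrArg Matrix.det (c.toMatrix_mul_toMatrix_flip b)
    rw [Matrix.det_mul, Matrix.det_one] at h
    exact left_ne_zero_of_mul_eq_one h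
  rw [height, ← heightOfFamily_mul (c.toMatrix b).transpose (by rwa [Matrix.det_transpose])]
  congr 1
  funext i
  have h : ((∑ l, c.toMatrix b l i • c l : T) : Fin m → K) = b i := by
    rw [c.sum_toMatrix_smul_self]
  rw [Submodule.coe_sum] at h
  exact h

end HeightWellDefined

end SchmidtApprox

end

noncomputable section

namespace SchmidtApprox

/-! ### Determinants and exterior products of nearly proportional vectors -/

section Wedge

variable {𝕜 : Type*} [RCLike 𝕜]

/-! The lower bound comes from Minkowski's second theorem over `K`, applied to a one-parameter
family of norms. Let `φ₀` be the given embedding into `ℂ`, and scale `u` to `v` with `v k₀ = 1`. For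
`t ≥ 0`, measure `x` at `φ₀` by `exp (-n t) |x k₀|` and `exp t |x k - x k₀ v k|`, conjugately at the
conjugate embedding, and by the coordinates themselves elsewhere. These linear maps have determinant
of modulus `1`, so `exists_integral_basis_prod_le` gives a `K`-basis of integral vectors `x i`, of
size at most `a i` at every embedding, with `a` increasing and `∏ a i` bounded independently of `t`.
Take for `S` the span of the first `j + 1` vectors.

At `φ₀` each `x i` is a multiple of `u` of size at most `exp (n t) a i` plus an error of size `exp
(-t) a i`. A wedge product can use the direction `u` only once, so its norm `W` is `≪ exp (n t) exp
(-j t)` (`wedgeNorm_le_of_near_line`). Wedging also with `u` leaves only errors, whence `W ω₁(u, S)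
≪ exp (-(j + 1) t)` (`wedgeNorm_mul_omegaI_le`). At embeddings other than `φ₀` and its conjugate the
wedge is bounded. Integrality gives `N(𝔞)⁻¹ ≤ 1`, so `H(S)` is at most the product of the wedge
norms, where `W` occurs `q` times: `H(S) ≪ exp (q (n - j) t)` and `H(S) ω₁^q ≪ exp (-q (j + 1) t)`.
Taking `Q` equal to the first bound makes the second `≪ Q ^ (-(j + 1) / (n - j))`; any smaller
exponent absorbs the constant for large `Q`. -/

theorem norm_det_le_factorial_mul_prod {ι : Type*} [Fintype ι] [DecidableEq ι]
    (A : Matrix ι ι 𝕜) (r : ι → ℝ) (h : ∀ i j, ‖A i j‖ ≤ r i) :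
    ‖A.det‖ ≤ (Fintype.card ι).factorial * ∏ i, r i := by
  rw [← Matrix.det_transpose, Matrix.det_apply]
  refine (norm_sum_le _ _).trans ?_
  have h1 : ∀ τ ∈ (Finset.univ : Finset (Equiv.Perm ι)),
      ‖Equiv.Perm.sign τ • ∏ i, A.transpose (τ i) i‖ ≤ ∏ i, r i := by
    intro τ _
    have h2 : ‖Equiv.Perm.sign τ • ∏ i, A.transpose (τ i) i‖ = ∏ i, ‖A i (τ i)‖ := by
      rcases Int.units_eq_one_or (Equiv.Perm.sign τ) with h | h <;> simp [h, norm_prod]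
    rw [h2]
    exact Finset.prod_le_prod (fun i _ => norm_nonneg _) (fun i _ => h i _)
  refine (Finset.sum_le_card_nsmul _ _ _ h1).trans ?_
  rw [Finset.card_univ, Fintype.card_perm, nsmul_eq_mul]

theorem sqrt_sum_sq_le_card_mul {ι : Type*} [Fintype ι] {f : ι → ℝ} {c : ℝ} (hc : 0 ≤ c)
    (hf : ∀ i, ‖f i‖ ≤ c) : √(∑ i, f i ^ 2) ≤ Fintype.card ι * c := by
  rw [Real.sqrt_le_left (by positivity)]
  have h1 : ∑ i, f i ^ 2 ≤ Fintype.card ι * c ^ 2 := by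
    have h2 : ∀ i ∈ (Finset.univ : Finset ι), f i ^ 2 ≤ c ^ 2 := fun i _ => by
      rw [← sq_abs]
      exact pow_le_pow_left₀ (abs_nonneg _) (hf i) 2
    simpa using Finset.sum_le_card_nsmul _ _ _ h2
  refine h1.trans ?_
  rw [mul_pow]
  gcongr
  have : (Fintype.card ι) ≤ Fintype.card ι ^ 2 := Nat.le_self_pow (by norm_num) _
  exact_mod_cast this

/-- The number of coordinates of a `d`-fold exterior product of vectors of length `m`. -/
abbrev wedgeDim (d m : ℕ) : ℝ := Fintype.card (Set.powersetCard (Fin m) d)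

theorem wedgeNorm_nonneg {d m : ℕ} (X : Fin d → Fin m → 𝕜) : 0 ≤ wedgeNorm X := Real.sqrt_nonneg _

theorem wedgeNorm_le_of_coord_le {d m : ℕ} (X : Fin d → Fin m → 𝕜) {c : ℝ} (hc : 0 ≤ c)
    (h : ∀ s, ‖wedgeCoord X s‖ ≤ c) : wedgeNorm X ≤ wedgeDim d m * c :=
  sqrt_sum_sq_le_card_mul hc (fun s => by simpa using h s)

theorem wedgeNorm_le_of_entry_le {d m : ℕ} (X : Fin d → Fin m → 𝕜) (r : Fin d → ℝ)
    (hr : ∀ i, 0 ≤ r i) (h : ∀ i k, ‖X i k‖ ≤ r i) :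
    wedgeNorm X ≤ wedgeDim d m * (d.factorial * ∏ i, r i) := by
  refine wedgeNorm_le_of_coord_le X
    (mul_nonneg (Nat.cast_nonneg _) (Finset.prod_nonneg fun i _ => hr i)) fun s => ?_
  rw [wedgeCoord_eq_det]
  have h1 := norm_det_le_factorial_mul_prod
    ((Matrix.of X).submatrix id (Set.powersetCard.ofFinEmbEquiv.symm s)) r (fun i k => h i _)
  rwa [Fintype.card_fin] at h1

/-- A determinant all of whose rows are close to multiples of one vector. -/
theorem norm_det_le_of_near_line {ι : Type*} [Fintype ι] [DecidableEq ι] [Nonempty ι]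
    (A : Matrix ι ι 𝕜) (u : ι → 𝕜) (α : ι → 𝕜) (p : ι → ι → 𝕜) (a : ι → ℝ) {R U ε : ℝ}
    (ha : ∀ i, 0 < a i) (hU : 1 ≤ U) (hε : 0 ≤ ε) (hεR : ε ≤ R)
    (hA : ∀ i k, A i k = α i * u k + p i k) (hu : ∀ k, ‖u k‖ ≤ U) (hα : ∀ i, ‖α i‖ ≤ R * a i)
    (hp : ∀ i k, ‖p i k‖ ≤ ε * a i) :
    ‖A.det‖ ≤ (Fintype.card ι).factorial *
      (2 ^ Fintype.card ι * U * R * ε ^ (Fintype.card ι - 1) * ∏ i, a i) := by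
  -- Row `l` serves as pivot to clear the `u`-part of all other rows. Maximality of `‖α l‖ / a l`
  -- gives `‖c i‖ * a l ≤ a i`, so the errors at most double: one row keeps size `R`, the others
  -- have size `ε`.
  obtain ⟨l, -, hl⟩ := Finset.exists_max_image Finset.univ (fun i => ‖α i‖ / a i)
    Finset.univ_nonempty
  have hR : 0 ≤ R := hε.trans hεR
  have hU0 : 0 ≤ U := zero_le_one.trans hU
  set c : ι → 𝕜 := fun i => if i = l then 0 else α i / α l with hc
  have hlc : c l = 0 := by simp [hc]
  let B : Matrix ι ι 𝕜 := fun i k => A i k - c i * A l k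
  have hdet : A.det = B.det := by
    refine Matrix.det_eq_of_forall_row_eq_smul_add_const c l hlc (fun i k => ?_)
    simp [B, hlc]
  let r : ι → ℝ := fun i => (if i = l then 2 * U * R else 2 * ε) * a i
  have hr : ∀ i k, ‖B i k‖ ≤ r i := by
    intro i k
    have hai := ha i
    by_cases hil : i = l
    · subst hil
      simp only [B, r, hlc, zero_mul, sub_zero, if_true, hA]
      calc ‖α i * u k + p i k‖ ≤ ‖α i‖ * ‖u k‖ + ‖p i k‖ := by
            rw [← norm_mul]; exact norm_add_le _ _
        _ ≤ (R * a i) * U + (R * U) * a i := by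
            have h1 : ‖p i k‖ ≤ (R * U) * a i := (hp i k).trans (by
              gcongr
              nlinarith)
            have h2 := hα i
            have h3 := hu k
            gcongr
        _ = 2 * U * R * a i := by ring
    · have hB : B i k = p i k - c i * p l k := by
        simp only [B, hA, hc, hil, if_false]
        -- If `α l = 0`, maximality forces every `α i` to vanish, so the convention `x / 0 = 0` does
        -- no harm.
        by_cases h0 : α l = 0
        · have h1 : ‖α i‖ / a i ≤ 0 := by simpa [h0] using hl i (Finset.mem_univ _)
          have h2 : α i = 0 := by
            by_contra h
            have : 0 < ‖α i‖ / a i := by positivity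
            linarith
          simp [h0, h2]
        · field_simp
          ring
      have hal := ha l
      have hcn : ‖c i‖ * a l ≤ a i := by
        simp only [hc, hil, if_false, norm_div]
        by_cases h0 : α l = 0
        · simp [h0, hai.le]
        · have h1 := hl i (Finset.mem_univ _)
          rw [div_le_div_iff₀ hai hal] at h1
          have : 0 < ‖α l‖ := by positivity
          rw [div_mul_eq_mul_div, div_le_iff₀ this]
          linarith
      simp only [r, hil, if_false]
      rw [hB]
      calc ‖p i k - c i * p l k‖ ≤ ‖p i k‖ + ‖c i‖ * ‖p l k‖ := by
            rw [← norm_mul]; exact norm_sub_le _ _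
        _ ≤ ε * a i + ‖c i‖ * (ε * a l) := by
            have h1 := hp i k
            have h2 := hp l k
            gcongr
        _ = ε * a i + ε * (‖c i‖ * a l) := by ring
        _ ≤ ε * a i + ε * a i := by gcongr
        _ = 2 * ε * a i := by ring
  have hprod : ∏ i, r i = 2 ^ Fintype.card ι * U * R * ε ^ (Fintype.card ι - 1) * ∏ i, a i := by
    obtain ⟨N, hN⟩ : ∃ N, Fintype.card ι = N + 1 := Nat.exists_eq_succ_of_ne_zero Fintype.card_ne_zero
    simp only [r, Finset.prod_mul_distrib]
    rw [← Finset.mul_prod_erase _ _ (Finset.mem_univ l)]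
    rw [Finset.prod_congr (g := fun _ => 2 * ε) rfl
      (fun i hi => by rw [if_neg (Finset.ne_of_mem_erase hi)])]
    rw [Finset.prod_const, Finset.card_erase_of_mem (Finset.mem_univ _), Finset.card_univ, hN]
    simp only [if_true, Nat.add_sub_cancel]
    ring
  rw [hdet, ← hprod]
  exact norm_det_le_factorial_mul_prod B r hr

theorem wedgeNorm_le_of_near_line {d m : ℕ} (hd : 0 < d) (X : Fin d → Fin m → 𝕜) (u : Fin m → 𝕜)
    (α : Fin d → 𝕜) (p : Fin d → Fin m → 𝕜) (a : Fin d → ℝ) {R U ε : ℝ}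
    (ha : ∀ i, 0 < a i) (hU : 1 ≤ U) (hε : 0 ≤ ε) (hεR : ε ≤ R)
    (hX : ∀ i k, X i k = α i * u k + p i k) (hu : ∀ k, ‖u k‖ ≤ U) (hα : ∀ i, ‖α i‖ ≤ R * a i)
    (hp : ∀ i k, ‖p i k‖ ≤ ε * a i) :
    wedgeNorm X ≤ wedgeDim d m * (d.factorial *
      (2 ^ d * U * R * ε ^ (d - 1) * ∏ i, a i)) := by
  have : Nonempty (Fin d) := ⟨⟨0, hd⟩⟩
  have hR : 0 ≤ R := hε.trans hεR
  have hU0 : 0 ≤ U := zero_le_one.trans hU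
  have ha' : 0 ≤ ∏ i, a i := Finset.prod_nonneg fun i _ => (ha i).le
  refine wedgeNorm_le_of_coord_le X (by positivity) fun s => ?_
  rw [wedgeCoord_eq_det]
  have h := norm_det_le_of_near_line
    ((Matrix.of X).submatrix id (Set.powersetCard.ofFinEmbEquiv.symm s))
    (fun k => u (Set.powersetCard.ofFinEmbEquiv.symm s k)) α
    (fun i k => p i (Set.powersetCard.ofFinEmbEquiv.symm s k)) a ha hU hε hεR
    (fun i k => hX i _) (fun k => hu _) hα (fun i k => hp i _)
  simpa using h

/-- Solving for `u` in the columns `s` by a combination `Y` of the rows of `X`, the difference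
`u - Y` is small. -/
theorem exists_combination_near {d m : ℕ} (X : Fin d → Fin m → 𝕜) (u : Fin m → 𝕜)
    (α : Fin d → 𝕜) (p : Fin d → Fin m → 𝕜) (a : Fin d → ℝ) {U ε : ℝ}
    (hX : ∀ i k, X i k = α i * u k + p i k) (hu : ∀ k, ‖u k‖ ≤ U)
    (hp : ∀ i k, ‖p i k‖ ≤ ε * a i) (s : Set.powersetCard (Fin m) d)
    (hs : wedgeCoord X s ≠ 0) :
    ∃ c : Fin d → 𝕜, ∀ k, ‖wedgeCoord X s‖ * ‖u k - ∑ i, c i * X i k‖ ≤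
      (d + 1).factorial * (ε ^ d * (∏ i, a i) * U) := by
  set f : Fin d → Fin m := ⇑(Set.powersetCard.ofFinEmbEquiv.symm s)
  set A : Matrix (Fin d) (Fin d) 𝕜 := (Matrix.of X).submatrix id f
  have hA : wedgeCoord X s = A.det := wedgeCoord_eq_det X s
  have hAu : IsUnit A.det := isUnit_iff_ne_zero.mpr (hA ▸ hs)
  let _ : Invertible A := Matrix.invertibleOfIsUnitDet A hAu
  refine ⟨Matrix.vecMul (fun k => u (f k)) (⅟A), fun k => ?_⟩
  -- Bordering `A` by column `k` and by `u` gives a matrix whose Schur complement is `u k - Y k`.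
  -- Subtracting multiples of the last row replaces the entries of `X` by those of `p`.
  let N : Matrix (Fin d ⊕ Unit) (Fin d ⊕ Unit) 𝕜 :=
    Matrix.fromBlocks A (.of fun i _ => X i k) (.of fun _ l => u (f l)) (.of fun _ _ => u k)
  let B : Matrix (Fin d ⊕ Unit) (Fin d ⊕ Unit) 𝕜 :=
    Matrix.fromBlocks (.of fun i l => p i (f l)) (.of fun i _ => p i k) (.of fun _ l => u (f l))
      (.of fun _ _ => u k)
  have hNB : N.det = B.det := by
    refine Matrix.det_eq_of_forall_row_eq_smul_add_const (Sum.elim α 0) (Sum.inr ()) rfl ?_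
    rintro (i | i) (l | l) <;> simp [N, B, A, hX, add_comm]
  have hN : N.det = A.det * (u k - ∑ i, Matrix.vecMul (fun k => u (f k)) (⅟A) i * X i k) := by
    simp only [N]
    rw [Matrix.det_fromBlocks₁₁]
    congr 1
    rw [Matrix.det_unique]
    simp only [Matrix.sub_apply, Matrix.mul_apply, Matrix.vecMul, dotProduct, Matrix.of_apply]
  rw [hA, ← norm_mul, ← hN, hNB]
  have h := norm_det_le_factorial_mul_prod B (Sum.elim (fun i => ε * a i) (fun _ => U)) (by
    rintro (i | i) (l | l)
    · exact hp i _
    · exact hp i _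
    · exact hu _
    · exact hu _)
  simpa [Finset.prod_mul_distrib] using h

/-! ### Projective distance and the angle to a subspace -/

theorem projDist_nonneg {m : ℕ} (X Y : EuclideanSpace 𝕜 (Fin m)) : 0 ≤ projDist X Y :=
  div_nonneg (wedgeNorm_nonneg _) (by positivity)

theorem wedgeNorm_pair_le {m : ℕ} (X Y : EuclideanSpace 𝕜 (Fin m)) :
    wedgeNorm ![X.ofLp, Y.ofLp] ≤ 2 * wedgeDim 2 m * (‖X‖ * ‖Y‖) := by
  have h := wedgeNorm_le_of_entry_le ![X.ofLp, Y.ofLp] ![‖X‖, ‖Y‖]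
    (by intro i; fin_cases i <;> simp)
    (by
      intro i k
      fin_cases i
      · exact PiLp.norm_apply_le X k
      · exact PiLp.norm_apply_le Y k)
  refine h.trans (le_of_eq ?_)
  simp [Fin.prod_univ_two, Nat.factorial]
  ring

theorem wedgeNorm_pair_smul_left {m : ℕ} (c : 𝕜) (X Y : EuclideanSpace 𝕜 (Fin m)) :
    wedgeNorm ![(c • X).ofLp, Y.ofLp] = ‖c‖ * wedgeNorm ![X.ofLp, Y.ofLp] := by
  have h := wedgeNorm_mul !![c, 0; 0, 1] ![X.ofLp, Y.ofLp]
  rw [Matrix.det_fin_two_of] at h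
  simp only [mul_one, mul_zero, sub_zero] at h
  rw [← h]
  congr 1
  funext i
  fin_cases i <;> simp [Fin.sum_univ_two]

theorem wedgeNorm_pair_sub {m : ℕ} (X Y : EuclideanSpace 𝕜 (Fin m)) :
    wedgeNorm ![(X - Y).ofLp, Y.ofLp] = wedgeNorm ![X.ofLp, Y.ofLp] := by
  have h := wedgeNorm_mul !![1, -1; 0, 1] ![X.ofLp, Y.ofLp]
  rw [Matrix.det_fin_two_of] at h
  simp only [mul_one, mul_zero, sub_zero, norm_one, one_mul] at h
  rw [← h]
  congr 1
  funext i
  fin_cases i <;> simp [Fin.sum_univ_two, sub_eq_add_neg]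

theorem projDist_smul_left {m : ℕ} {c : 𝕜} (hc : c ≠ 0) (X Y : EuclideanSpace 𝕜 (Fin m)) :
    projDist (c • X) Y = projDist X Y := by
  have : ‖c‖ ≠ 0 := by simpa using hc
  rw [projDist, projDist, wedgeNorm_pair_smul_left, norm_smul, mul_assoc,
    mul_div_mul_left _ _ this]

theorem projDist_le {m : ℕ} (X Y : EuclideanSpace 𝕜 (Fin m)) :
    projDist X Y ≤ 2 * wedgeDim 2 m :=
  div_le_of_le_mul₀ (by positivity) (by positivity) (wedgeNorm_pair_le X Y)

/-- Since `X ∧ Y = (X - Y) ∧ Y`, the factor `‖Y‖` cancels. -/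
theorem projDist_le_norm_sub_div {m : ℕ} (X Y : EuclideanSpace 𝕜 (Fin m)) :
    projDist X Y ≤ 2 * wedgeDim 2 m * (‖X - Y‖ / ‖X‖) := by
  by_cases hX : X = 0
  · simp [projDist, hX]
  by_cases hY : Y = 0
  · simp only [projDist, hY, norm_zero, mul_zero, div_zero]; positivity
  have hX' : 0 < ‖X‖ := by positivity
  have hY' : 0 < ‖Y‖ := by positivity
  rw [projDist, ← wedgeNorm_pair_sub, div_le_iff₀ (by positivity)]
  refine (wedgeNorm_pair_le _ _).trans (le_of_eq ?_)
  field_simp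

/-- With `F = Span(u)`, every nonzero `X ∈ F` is a multiple of `u` and has the same distance to `Y`.
-/
theorem omegaI_one_span_le {m : ℕ} {u : EuclideanSpace 𝕜 (Fin m)} (hu : u ≠ 0)
    {S : Submodule 𝕜 (EuclideanSpace 𝕜 (Fin m))} {Y : EuclideanSpace 𝕜 (Fin m)} (hY : Y ∈ S)
    (hY0 : Y ≠ 0) : omegaI 1 (Submodule.span 𝕜 {u}) S ≤ projDist u Y := by
  have hd : ∀ X, 0 ≤ distToSubspace X S := fun X => Real.iInf_nonneg fun _ => projDist_nonneg _ _
  refine (ciInf_le ⟨0, ?_⟩ ⟨Submodule.span 𝕜 {u}, le_rfl, finrank_span_singleton hu⟩).trans ?_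
  · rintro _ ⟨F, rfl⟩
    exact Real.iSup_nonneg fun X => hd _
  · have : Nonempty {X : EuclideanSpace 𝕜 (Fin m) // X ∈ Submodule.span 𝕜 {u} ∧ X ≠ 0} :=
      ⟨⟨u, Submodule.mem_span_singleton_self u, hu⟩⟩
    refine ciSup_le ?_
    rintro ⟨X, hX, hX0⟩
    obtain ⟨c, rfl⟩ := Submodule.mem_span_singleton.mp hX
    have hc : c ≠ 0 := by rintro rfl; simp at hX0
    have hbdd : BddBelow (Set.range fun Z : {Z : EuclideanSpace 𝕜 (Fin m) // Z ∈ S ∧ Z ≠ 0} =>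
        projDist (c • u) Z.1) := ⟨0, by rintro _ ⟨F, rfl⟩; exact projDist_nonneg _ _⟩
    have h := ciInf_le hbdd ⟨Y, hY, hY0⟩
    rw [projDist_smul_left hc u Y] at h
    exact h

theorem omegaI_nonneg {m : ℕ} (i : ℕ) (A B : Submodule 𝕜 (EuclideanSpace 𝕜 (Fin m))) :
    0 ≤ omegaI i A B :=
  Real.iInf_nonneg fun _ => Real.iSup_nonneg fun _ => Real.iInf_nonneg fun _ => projDist_nonneg _ _

/-- The constant in `wedgeNorm_mul_omegaI_le`. -/
def angleConst (d m : ℕ) (U V : ℝ) : ℝ :=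
  wedgeDim d m * (2 * wedgeDim 2 m * (m * ((d + 1).factorial * U) / V))

theorem angleConst_nonneg {d m : ℕ} {U V : ℝ} (hU : 0 ≤ U) (hV : 0 ≤ V) :
    0 ≤ angleConst d m U V := by
  unfold angleConst; positivity

/-- If the rows of `X` are close to multiples of `u`, then so is their span. -/
theorem wedgeNorm_mul_omegaI_le {d m : ℕ} (X : Fin d → Fin m → 𝕜)
    {u : EuclideanSpace 𝕜 (Fin m)} (hu0 : u ≠ 0)
    (α : Fin d → 𝕜) (p : Fin d → Fin m → 𝕜) (a : Fin d → ℝ) {U ε : ℝ}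
    (ha : ∀ i, 0 < a i) (hU : 0 ≤ U) (hε : 0 ≤ ε)
    (hX : ∀ i k, X i k = α i * u k + p i k) (hu : ∀ k, ‖u k‖ ≤ U)
    (hp : ∀ i k, ‖p i k‖ ≤ ε * a i) {S : Submodule 𝕜 (EuclideanSpace 𝕜 (Fin m))}
    (hS : ∀ i, WithLp.toLp 2 (X i) ∈ S) (hS0 : S ≠ ⊥) :
    wedgeNorm X * omegaI 1 (Submodule.span 𝕜 {u}) S ≤
      angleConst d m U ‖u‖ * (ε ^ d * ∏ i, a i) := by
  have hu' : 0 < ‖u‖ := by positivity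
  have ha' : 0 ≤ ∏ i, a i := Finset.prod_nonneg fun i _ => (ha i).le
  have hrhs : 0 ≤ angleConst d m U ‖u‖ * (ε ^ d * ∏ i, a i) :=
    mul_nonneg (angleConst_nonneg hU hu'.le) (by positivity)
  by_cases hw : ∀ s, wedgeCoord X s = 0
  · have : wedgeNorm X = 0 := by simp [wedgeNorm, hw]
    rw [this, zero_mul]
    exact hrhs
  push Not at hw
  obtain ⟨s₀, hs₀⟩ := hw
  -- The largest minor is comparable to `wedgeNorm X`, and it is also the factor divided out when
  -- solving for `u` in its columns; the two cancel.
  obtain ⟨s, -, hs⟩ := Finset.exists_max_image Finset.univ (fun s => ‖wedgeCoord X s‖)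
    ⟨s₀, Finset.mem_univ _⟩
  have hsne : wedgeCoord X s ≠ 0 := by
    have := hs s₀ (Finset.mem_univ _)
    intro h
    rw [h, norm_zero, norm_le_zero_iff] at this
    exact hs₀ this
  have hXle : wedgeNorm X ≤ wedgeDim d m * ‖wedgeCoord X s‖ :=
    wedgeNorm_le_of_coord_le X (norm_nonneg _) fun t => hs t (Finset.mem_univ _)
  obtain ⟨c, hc⟩ := exists_combination_near X u α p a hX hu hp s hsne
  set Y : EuclideanSpace 𝕜 (Fin m) := ∑ i, c i • WithLp.toLp 2 (X i) with hY
  have hYS : Y ∈ S := Submodule.sum_mem _ fun i _ => S.smul_mem _ (hS i)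
  have hΔ : 0 < ‖wedgeCoord X s‖ := by positivity
  set E : ℝ := (d + 1).factorial * (ε ^ d * (∏ i, a i) * U)
  have hE : 0 ≤ E := by positivity
  have hdiff : ‖wedgeCoord X s‖ * ‖u - Y‖ ≤ m * E := by
    have h1 : ‖u - Y‖ ≤ m * (E / ‖wedgeCoord X s‖) := by
      rw [EuclideanSpace.norm_eq]
      have h2 := sqrt_sum_sq_le_card_mul (f := fun k => ‖(u - Y) k‖) (c := E / ‖wedgeCoord X s‖)
        (by positivity) (fun k => by
          rw [norm_norm, le_div_iff₀ hΔ, mul_comm]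
          have h3 : (u - Y) k = u k - ∑ i, c i * X i k := by
            simp [hY, WithLp.ofLp_sum, Finset.sum_apply]
          rw [h3]
          exact hc k)
      simpa using h2
    calc ‖wedgeCoord X s‖ * ‖u - Y‖ ≤ ‖wedgeCoord X s‖ * (m * (E / ‖wedgeCoord X s‖)) := by gcongr
      _ = m * E := by field_simp
  -- If `Y = 0` the right side is the trivial bound for `projDist`, so any nonzero vector of `S`
  -- will do.
  obtain ⟨Z, hZS, hZ0, hZ⟩ : ∃ Z ∈ S, Z ≠ 0 ∧
      projDist u Z ≤ 2 * wedgeDim 2 m * (‖u - Y‖ / ‖u‖) := by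
    by_cases hY0 : Y = 0
    · obtain ⟨Z, hZS, hZ0⟩ := S.exists_mem_ne_zero_of_ne_bot hS0
      refine ⟨Z, hZS, hZ0, (projDist_le u Z).trans (le_of_eq ?_)⟩
      rw [hY0, sub_zero, div_self hu'.ne', mul_one]
    · exact ⟨Y, hYS, hY0, projDist_le_norm_sub_div u Y⟩
  calc wedgeNorm X * omegaI 1 (Submodule.span 𝕜 {u}) S
      ≤ (wedgeDim d m * ‖wedgeCoord X s‖) * (2 * wedgeDim 2 m * (‖u - Y‖ / ‖u‖)) :=
        mul_le_mul hXle ((omegaI_one_span_le hu0 hZS hZ0).trans hZ) (omegaI_nonneg _ _ _)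
          (by positivity)
    _ = wedgeDim d m * (2 * wedgeDim 2 m * ((‖wedgeCoord X s‖ * ‖u - Y‖) / ‖u‖)) := by ring
    _ ≤ wedgeDim d m * (2 * wedgeDim 2 m * ((m * E) / ‖u‖)) := by gcongr
    _ = angleConst d m U ‖u‖ * (ε ^ d * ∏ i, a i) := by
        simp only [E, angleConst]; ring

end Wedge

/-! ### Greedy sequences -/

section Greedy

variable {R M : Type*} [DivisionRing R] [AddCommGroup M] [Module R M]

/-- The sequence each term of which is picked depending on the span of the previous terms. -/
def greedySeq (pick : Submodule R M → M) (k : ℕ) : M :=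
  pick (Submodule.span R (Set.range fun i : Fin k => greedySeq pick i))
termination_by k
decreasing_by exact i.2

/-- The span of the terms of index less than `k` of a sequence. -/
def spanLT (R : Type*) {M : Type*} [DivisionRing R] [AddCommGroup M] [Module R M] (z : ℕ → M)
    (k : ℕ) : Submodule R M :=
  Submodule.span R (Set.range fun i : Fin k => z i)

theorem greedySeq_eq (pick : Submodule R M → M) (k : ℕ) :
    greedySeq pick k = pick (spanLT R (greedySeq pick) k) := by
  rw [greedySeq, spanLT]

theorem spanLT_mono (z : ℕ → M) {k l : ℕ} (h : k ≤ l) : spanLT R z k ≤ spanLT R z l := by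
  apply Submodule.span_mono
  rintro _ ⟨i, rfl⟩
  exact ⟨⟨i, i.2.trans_le h⟩, rfl⟩

theorem finrank_spanLT_le (z : ℕ → M) (k : ℕ) : Module.finrank R (spanLT R z k) ≤ k := by
  exact (finrank_range_le_card (R := R) (fun i : Fin k => z i)).trans (Fintype.card_fin k).le

theorem linearIndependent_of_notMem_spanLT (z : ℕ → M) (N : ℕ)
    (h : ∀ k < N, z k ∉ spanLT R z k) : LinearIndependent R (fun i : Fin N => z i) := by
  induction N with
  | zero => exact linearIndependent_empty_type
  | succ N ih =>
    rw [linearIndependent_finSucc']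
    exact ⟨ih fun k hk => h k (by omega), h N (by omega)⟩

end Greedy

/-! ### Minkowski's second theorem -/

section Minkowski

variable {E ι : Type*} [NormedAddCommGroup E] [InnerProductSpace ℝ E] [FiniteDimensional ℝ E]

/-- Some basis vector lies outside `S`, and only finitely many lattice points are no longer than it.
-/
theorem exists_min_norm_notMem [Finite ι] (b : Module.Basis ι ℝ E) (S : Submodule ℝ E) (hS : S ≠ ⊤) :
    ∃ x ∈ Submodule.span ℤ (Set.range b), x ∉ S ∧
      ∀ y ∈ Submodule.span ℤ (Set.range b), y ∉ S → ‖x‖ ≤ ‖y‖ := by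
  have hex : ∃ i, b i ∉ S := by
    by_contra! h
    apply hS
    rw [eq_top_iff, ← b.span_eq, Submodule.span_le]
    rintro _ ⟨i, rfl⟩
    exact h i
  obtain ⟨i, hi⟩ := hex
  have hfin : ((Metric.closedBall (0 : E) ‖b i‖ ∩ Submodule.span ℤ (Set.range b)) \ S).Finite :=
    (ZSpan.setFinite_inter b Metric.isBounded_closedBall).sdiff
  have hbi : b i ∈ Submodule.span ℤ (Set.range b) := Submodule.subset_span ⟨i, rfl⟩
  obtain ⟨x, ⟨⟨hx1, hx2⟩, hx3⟩, hx⟩ := Set.exists_min_image _ (fun x => ‖x‖) hfin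
    ⟨b i, ⟨by simp, hbi⟩, hi⟩
  refine ⟨x, hx2, hx3, fun y hy hyS => ?_⟩
  by_cases hyb : ‖y‖ ≤ ‖b i‖
  · exact hx y ⟨⟨by simpa using hyb, hy⟩, hyS⟩
  · exact (hx (b i) ⟨⟨by simp, hbi⟩, hi⟩).trans (not_le.mp hyb).le

theorem exists_successive_minima [Finite ι] (b : Module.Basis ι ℝ E) :
    ∃ z : ℕ → E, ∀ k < Module.finrank ℝ E, z k ∈ Submodule.span ℤ (Set.range b) ∧
      z k ∉ spanLT ℝ z k ∧
      ∀ y ∈ Submodule.span ℤ (Set.range b), y ∉ spanLT ℝ z k → ‖z k‖ ≤ ‖y‖ := by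
  classical
  choose! pick hpick using exists_min_norm_notMem b
  refine ⟨greedySeq pick, fun k hk => ?_⟩
  rw [greedySeq_eq]
  refine hpick _ fun h => ?_
  have := finrank_spanLT_le (R := ℝ) (greedySeq pick) k
  rw [h, finrank_top] at this
  omega

/-- The linear map dividing the `i`-th Gram–Schmidt coordinate with respect to `z` by `‖z i‖`. -/
def gramSchmidtScale (z : ℕ → E) : E →ₗ[ℝ] E :=
  let e := InnerProductSpace.gramSchmidtOrthonormalBasis (𝕜 := ℝ)
    (Fintype.card_fin (Module.finrank ℝ E)).symm (fun i => z i)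
  Matrix.toLin e.toBasis e.toBasis (Matrix.diagonal fun i => ‖z i‖⁻¹)

theorem det_gramSchmidtScale (z : ℕ → E) :
    LinearMap.det (gramSchmidtScale z) = ∏ i : Fin (Module.finrank ℝ E), ‖z i‖⁻¹ := by
  rw [gramSchmidtScale, LinearMap.det_toLin, Matrix.det_diagonal]

/-- Let `k` be such that `x` enters the spans on adding `z k`. Minimality gives `‖z k‖ ≤ ‖x‖`. Only
Gram–Schmidt coordinates of index at most `k` occur in `x`, and each is divided by some `‖z i‖ ≤ ‖z
k‖`, so the image has norm at least `‖x‖ / ‖z k‖`. -/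
theorem one_le_norm_gramSchmidtScale (b : Module.Basis ι ℝ E) (z : ℕ → E)
    (hz : ∀ k < Module.finrank ℝ E, z k ∈ Submodule.span ℤ (Set.range b) ∧
      z k ∉ spanLT ℝ z k ∧
      ∀ y ∈ Submodule.span ℤ (Set.range b), y ∉ spanLT ℝ z k → ‖z k‖ ≤ ‖y‖)
    {x : E} (hx : x ∈ Submodule.span ℤ (Set.range b)) (hx0 : x ≠ 0) :
    1 ≤ ‖gramSchmidtScale z x‖ := by
  classical
  set N := Module.finrank ℝ E with hN
  set e := InnerProductSpace.gramSchmidtOrthonormalBasis (𝕜 := ℝ)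
    (Fintype.card_fin (Module.finrank ℝ E)).symm (fun i => z i) with he
  have hli : LinearIndependent ℝ (fun i : Fin N => z i) :=
    linearIndependent_of_notMem_spanLT z N fun k hk => (hz k hk).2.1
  have htop : spanLT ℝ z N = ⊤ := hli.span_eq_top_of_card_eq_finrank' (by simp [hN])
  have hex : ∃ k, x ∈ spanLT ℝ z k := ⟨N, htop ▸ Submodule.mem_top⟩
  obtain ⟨k, hk, hmin⟩ : ∃ k, x ∈ spanLT ℝ z (k + 1) ∧ x ∉ spanLT ℝ z k := by
    have h0 : Nat.find hex ≠ 0 := by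
      intro h
      have := Nat.find_spec hex
      rw [h] at this
      simp only [spanLT, Set.range_eq_empty, Submodule.span_empty, Submodule.mem_bot] at this
      exact hx0 this
    obtain ⟨k, hk⟩ := Nat.exists_eq_succ_of_ne_zero h0
    have h1 := Nat.find_spec hex
    rw [hk] at h1
    exact ⟨k, h1, Nat.find_min hex (by omega)⟩
  have hkN : k < N := by
    by_contra! h
    exact hmin (spanLT_mono z h (htop ▸ Submodule.mem_top))
  have hpos : ∀ i < N, 0 < ‖z i‖ := fun i hi =>
    norm_pos_iff.mpr fun h => (hz i hi).2.1 (h ▸ Submodule.zero_mem _)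
  have hmono : ∀ i ≤ k, ‖z i‖ ≤ ‖z k‖ := fun i hi =>
    (hz i (by omega)).2.2 _ (hz k hkN).1 fun h => (hz k hkN).2.1 (spanLT_mono z hi h)
  have hle : ‖z k‖ ≤ ‖x‖ := (hz k hkN).2.2 x hx hmin
  have hzero : ∀ i : Fin N, k < i → e.repr x i = 0 := by
    intro i hi
    rw [e.repr_apply_apply]
    have h1 : spanLT ℝ z (k + 1) ≤ LinearMap.ker (innerSL ℝ (e i)).toLinearMap := by
      rw [spanLT, Submodule.span_le]
      rintro _ ⟨l, rfl⟩
      have hl : (⟨l, by omega⟩ : Fin N) < i := by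
        rw [Fin.lt_def]; simp only; omega
      exact InnerProductSpace.gramSchmidtOrthonormalBasis_inv_triangular
        (Fintype.card_fin (Module.finrank ℝ E)).symm (fun i : Fin N => z i) hl
    exact h1 hk
  have hcoord : ∀ i : Fin N, e.repr (gramSchmidtScale z x) i = ‖z i‖⁻¹ * e.repr x i := by
    intro i
    have h := congrFun (LinearMap.toMatrix_mulVec_repr e.toBasis e.toBasis (gramSchmidtScale z) x) i
    rw [gramSchmidtScale, LinearMap.toMatrix_toLin, Matrix.mulVec_diagonal] at h
    simpa [gramSchmidtScale] using h.symm
  have hsq : 1 ≤ ‖gramSchmidtScale z x‖ ^ 2 := by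
    rw [← e.repr.norm_map, EuclideanSpace.norm_sq_eq]
    have h1 : ∀ i : Fin N, ‖z k‖⁻¹ ^ 2 * ‖e.repr x i‖ ^ 2 ≤
        ‖e.repr (gramSchmidtScale z x) i‖ ^ 2 := by
      intro i
      rw [hcoord]
      by_cases hi : k < i
      · simp [hzero i hi]
      · rw [norm_mul, mul_pow, norm_inv, norm_norm]
        have := hmono i (by omega)
        have := hpos i i.2
        gcongr
    refine le_trans ?_ (Finset.sum_le_sum fun i _ => h1 i)
    rw [← Finset.mul_sum, ← EuclideanSpace.norm_sq_eq, e.repr.norm_map, ← mul_pow]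
    have := hpos k hkN
    apply one_le_pow₀
    rw [inv_mul_eq_div, le_div_iff₀ this, one_mul]
    exact hle
  exact (one_le_sq_iff₀ (norm_nonneg _)).mp hsq

variable [Fintype ι] [DecidableEq ι]

/-- **Minkowski's second theorem** for Euclidean norms, up to a constant. -/
theorem exists_linearIndependent_prod_norm_le (b₀ : Module.Basis ι ℝ E) {N : ℕ}
    (hN : Module.finrank ℝ E = N) :
    ∃ C : ℝ, 0 ≤ C ∧ ∀ b : Module.Basis ι ℝ E, ∃ z : Fin N → E,
      (∀ i, z i ∈ Submodule.span ℤ (Set.range b)) ∧ LinearIndependent ℝ z ∧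
      Monotone (fun i => ‖z i‖) ∧ ∏ i, ‖z i‖ ≤ C * |b₀.det b| := by
  subst hN
  let _ : MeasurableSpace E := borel E
  have : BorelSpace E := ⟨rfl⟩
  let μ : MeasureTheory.Measure E := MeasureTheory.Measure.addHaar
  set V := (μ (Metric.ball 0 1)).toReal with hV
  have hVpos : 0 < V := ENNReal.toReal_pos (Metric.measure_ball_pos _ _ one_pos).ne'
    MeasureTheory.measure_ball_lt_top.ne
  refine ⟨(μ (ZSpan.fundamentalDomain b₀)).toReal * 2 ^ Module.finrank ℝ E / V, by positivity,
    fun b => ?_⟩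
  obtain ⟨z, hz⟩ := exists_successive_minima b
  have hpos : ∀ i < Module.finrank ℝ E, 0 < ‖z i‖ := fun i hi =>
    norm_pos_iff.mpr fun h => (hz i hi).2.1 (h ▸ Submodule.zero_mem _)
  refine ⟨fun i => z i, fun i => (hz i i.2).1,
    linearIndependent_of_notMem_spanLT z _ fun k hk => (hz k hk).2.1, fun i l hil =>
      (hz i i.2).2.2 _ (hz l l.2).1 fun h => (hz l l.2).2.1 (spanLT_mono z hil h), ?_⟩
  set P := ∏ i : Fin (Module.finrank ℝ E), ‖z i‖ with hP
  have hPpos : 0 < P := Finset.prod_pos fun i _ => hpos i i.2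
  have hdet : LinearMap.det (gramSchmidtScale z) = P⁻¹ := by
    rw [det_gramSchmidtScale, hP, Finset.prod_inv_distrib]
  have hmeas : μ (gramSchmidtScale z ⁻¹' Metric.ball 0 1) = ENNReal.ofReal P * μ (Metric.ball 0 1) := by
    rw [MeasureTheory.Measure.addHaar_preimage_linearMap μ (by rw [hdet]; positivity), hdet,
      inv_inv, abs_of_pos hPpos]
  -- The preimage of the open unit ball contains no nonzero lattice point, so Minkowski's first
  -- theorem bounds its volume, which is `P` times that of the ball.
  have hle : μ (gramSchmidtScale z ⁻¹' Metric.ball 0 1) ≤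
      μ (ZSpan.fundamentalDomain b) * 2 ^ Module.finrank ℝ E := by
    by_contra! h
    have hfd := ZSpan.isAddFundamentalDomain b μ
    have : Countable (Submodule.span ℤ (Set.range b)).toAddSubgroup :=
      inferInstanceAs (Countable (Submodule.span ℤ (Set.range b)))
    obtain ⟨x, hx0, hx⟩ := MeasureTheory.exists_ne_zero_mem_lattice_of_measure_mul_two_pow_lt_measure
      (L := (Submodule.span ℤ (Set.range b)).toAddSubgroup) hfd
      (fun x hx => by simpa using hx) ((convex_ball 0 1).linear_preimage _) h
    have h1 := one_le_norm_gramSchmidtScale b z hz x.2 (by simpa using hx0)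
    rw [Set.mem_preimage, mem_ball_zero_iff] at hx
    linarith
  rw [hmeas, ZSpan.measure_fundamentalDomain b μ b₀] at hle
  have hfin : μ (ZSpan.fundamentalDomain b₀) ≠ ⊤ :=
    (ZSpan.fundamentalDomain_isBounded b₀).measure_lt_top.ne
  have h := ENNReal.toReal_mono (by finiteness) hle
  simp only [ENNReal.toReal_mul, ENNReal.toReal_pow, ENNReal.toReal_ofNat,
    ENNReal.toReal_ofReal hPpos.le, ENNReal.toReal_ofReal (abs_nonneg _)] at h
  rw [div_mul_eq_mul_div, le_div_iff₀ hVpos]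
  linarith

end Minkowski

/-! ### Integral points with small images under a complex matrix with real Gram matrix -/

section RealGram

open Matrix
open scoped MatrixOrder ComplexConjugate

variable {ι : Type*} [Fintype ι] [DecidableEq ι]

omit [DecidableEq ι] in
theorem star_dotProduct_gram_mulVec (M : Matrix ι ι ℂ) (w : ι → ℂ) :
    star w ⬝ᵥ (Mᴴ * M) *ᵥ w = ((∑ i, ‖(M *ᵥ w) i‖ ^ 2 : ℝ) : ℂ) := by
  rw [← mulVec_mulVec, dotProduct_mulVec, vecMul_conjTranspose, star_star]
  simp [dotProduct, Complex.conj_mul']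

/-- The Gram matrix is real and positive semidefinite, hence of the form `Bᵀ B` with `B` real. This
permits using all complex embeddings at once, without separating real and complex places. -/
theorem exists_real_of_gram_real (M : Matrix ι ι ℂ)
    (hreal : ∀ i j, conj ((Mᴴ * M) i j) = (Mᴴ * M) i j) :
    ∃ B : Matrix ι ι ℝ, |B.det| = ‖M.det‖ ∧ ∀ v : ι → ℝ,
      ‖WithLp.toLp 2 (B *ᵥ v)‖ = ‖WithLp.toLp 2 (M *ᵥ fun i => (v i : ℂ))‖ := by
  let G : Matrix ι ι ℝ := .of fun i j => ((Mᴴ * M) i j).re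
  have hG : G.map Complex.ofRealHom = Mᴴ * M := by
    ext i j
    exact Complex.conj_eq_iff_re.mp (hreal i j)
  have hquad : ∀ v : ι → ℝ, star v ⬝ᵥ G *ᵥ v = ∑ i, ‖(M *ᵥ fun i => (v i : ℂ)) i‖ ^ 2 := by
    intro v
    have h := star_dotProduct_gram_mulVec M fun i => (v i : ℂ)
    rw [← hG] at h
    apply Complex.ofReal_injective
    rw [← h]
    simp [dotProduct, mulVec]
  have hherm : G.IsHermitian := by
    ext i j
    have h := congrFun (congrFun (Matrix.isHermitian_conjTranspose_mul_self M) i) j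
    rw [conjTranspose_apply] at h
    have h2 := congrArg Complex.re h
    simpa [G] using h2
  have hpos : G.PosSemidef := .of_dotProduct_mulVec_nonneg hherm fun v => by
    rw [hquad]; positivity
  obtain ⟨B, hB⟩ := CStarAlgebra.nonneg_iff_eq_star_mul_self.mp hpos.nonneg
  rw [star_eq_conjTranspose] at hB
  refine ⟨B, ?_, fun v => ?_⟩
  · have h1 : ((G.det : ℝ) : ℂ) = (Mᴴ * M).det := by
      rw [← hG]
      exact RingHom.map_det Complex.ofRealHom G
    rw [det_mul, det_conjTranspose, hB, det_mul, det_conjTranspose] at h1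
    have h2 : B.det ^ 2 = ‖M.det‖ ^ 2 := by
      apply Complex.ofReal_injective
      have h3 : star M.det * M.det = ((‖M.det‖ ^ 2 : ℝ) : ℂ) := by
        simp [Complex.conj_mul']
      rw [← h3, ← h1]
      simp [sq]
    rw [← sq_eq_sq₀ (abs_nonneg _) (norm_nonneg _), sq_abs, h2]
  · rw [← sq_eq_sq₀ (norm_nonneg _) (norm_nonneg _), EuclideanSpace.norm_sq_eq,
      EuclideanSpace.norm_sq_eq, ← hquad, hB, ← mulVec_mulVec, dotProduct_mulVec,
      vecMul_conjTranspose, star_star]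
    simp [dotProduct, sq]

/-- Minkowski's second theorem for the quadratic form `z ↦ ‖M z‖²` on `ℤ^ι`. -/
theorem exists_int_linearIndependent_prod_le {N : ℕ} (hN : Fintype.card ι = N) :
    ∃ C : ℝ, 0 ≤ C ∧ ∀ M : Matrix ι ι ℂ, M.det ≠ 0 →
      (∀ i j, conj ((Mᴴ * M) i j) = (Mᴴ * M) i j) →
      ∃ (z : Fin N → ι → ℤ) (r : Fin N → ℝ), LinearIndependent ℝ (fun l i => (z l i : ℝ)) ∧
        Monotone r ∧ (∀ l, 0 < r l) ∧ (∀ l i, ‖(M *ᵥ fun k => (z l k : ℂ)) i‖ ≤ r l) ∧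
        ∏ l, r l ≤ C * ‖M.det‖ := by
  set b₀ : Module.Basis ι ℝ (EuclideanSpace ℝ ι) := (EuclideanSpace.basisFun ι ℝ).toBasis with hb₀
  obtain ⟨C, hC0, hC⟩ := exists_linearIndependent_prod_norm_le b₀ (N := N) (by simpa using hN)
  refine ⟨C, hC0, fun M hM hreal => ?_⟩
  obtain ⟨B, hBdet, hB⟩ := exists_real_of_gram_real M hreal
  have hunit : IsUnit B.det := by
    rw [isUnit_iff_ne_zero, ← abs_ne_zero, hBdet]
    exact norm_ne_zero_iff.mpr hM
  set T := Matrix.toLinearEquiv b₀ B hunit with hT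
  have hTdet : b₀.det (b₀.map T) = B.det := by
    have h := b₀.det_comp (T : EuclideanSpace ℝ ι →ₗ[ℝ] EuclideanSpace ℝ ι) b₀
    rw [b₀.det_self, mul_one] at h
    have h2 : (T : EuclideanSpace ℝ ι →ₗ[ℝ] EuclideanSpace ℝ ι) = Matrix.toLin b₀ b₀ B := by
      ext1 x; rfl
    have h3 : ⇑(b₀.map T) = ⇑(T : EuclideanSpace ℝ ι →ₗ[ℝ] EuclideanSpace ℝ ι) ∘ ⇑b₀ := by
      ext1 x; simp
    rw [h3, h, h2, LinearMap.det_toLin]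
  obtain ⟨y, hy, hyli, hymono, hyprod⟩ := hC (b₀.map T)
  have hz : ∀ l, ∃ z : ι → ℤ, y l = T (WithLp.toLp 2 fun i => (z i : ℝ)) := by
    intro l
    obtain ⟨z, hz⟩ := (Submodule.mem_span_range_iff_exists_fun ℤ).mp (hy l)
    refine ⟨z, ?_⟩
    rw [← hz]
    have h1 : WithLp.toLp 2 (fun i => (z i : ℝ)) = ∑ i, z i • b₀ i := by
      ext k
      simp [hb₀, WithLp.ofLp_sum, Finset.sum_apply, Pi.single_apply]
    rw [h1, map_sum]
    simp
  choose z hz using hz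
  have hTapply : ∀ v : ι → ℝ, T (WithLp.toLp 2 v) = WithLp.toLp 2 (B *ᵥ v) := by
    intro v
    ext k
    have h := congrFun (LinearMap.toMatrix_mulVec_repr b₀ b₀ (Matrix.toLin b₀ b₀ B)
      (WithLp.toLp 2 v)) k
    rw [LinearMap.toMatrix_toLin] at h
    exact h.symm
  refine ⟨z, fun l => ‖y l‖, ?_, hymono, fun l => norm_pos_iff.mpr (hyli.ne_zero l), ?_, ?_⟩
  · have h : y = ⇑(T.toLinearMap ∘ₗ (WithLp.linearEquiv 2 ℝ (ι → ℝ)).symm.toLinearMap) ∘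
        (fun l i => (z l i : ℝ)) := by
      funext l; exact hz l
    rw [h] at hyli
    exact hyli.of_comp _
  · intro l i
    have h := PiLp.norm_apply_le (WithLp.toLp 2 (M *ᵥ fun k => (((z l k : ℝ)) : ℂ))) i
    rw [← hB, ← hTapply, ← hz] at h
    simpa using h
  · rw [← hBdet, ← hTdet]
    exact hyprod

end RealGram

/-! ### Small integral points over a number field -/

section NumberFieldMinima

open Matrix
open scoped ComplexConjugate Kronecker

/-- From a family of `m D` vectors independent over `F`, select a basis over an extension `K` of
degree `D` by taking the `i`-th vector among the first `i D + 1` ones. -/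
theorem exists_linearIndependent_subfamily {F K V : Type*} [Field F] [Field K] [Algebra F K]
    [FiniteDimensional F K] [AddCommGroup V] [Module K V] [Module F V] [IsScalarTower F K V]
    [FiniteDimensional K V] {m N : ℕ}
    (hN : m * Module.finrank F K = N) (y : Fin N → V) (hy : LinearIndependent F y) :
    ∃ f : Fin m → Fin N, LinearIndependent K (y ∘ f) ∧
      ∀ i, (f i : ℕ) ≤ i * Module.finrank F K := by
  set D := Module.finrank F K with hD
  have hDpos : 0 < D := Module.finrank_pos
  -- A `K`-subspace of dimension `s` has dimension `s D` over `F`, so it cannot contain the first `s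
  -- D + 1` vectors.
  have key : ∀ S : Submodule K V, Module.finrank K S < m → ∃ v, v ∉ S ∧
      ∃ l : Fin N, (l : ℕ) ≤ Module.finrank K S * D ∧ v = y l := by
    intro S hS
    by_contra! h
    have hlt : Module.finrank K S * D < N := by
      rw [← hN]
      exact (Nat.mul_lt_mul_right hDpos).mpr hS
    have hmem : ∀ l : Fin (Module.finrank K S * D + 1), y ⟨l, by omega⟩ ∈ S := by
      intro l
      by_contra hl
      exact h _ hl ⟨l, by omega⟩ (by have := l.2; simp only; omega) rfl
    have hli : LinearIndependent F (fun l : Fin (Module.finrank K S * D + 1) =>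
        (⟨y ⟨l, by omega⟩, hmem l⟩ : S)) := by
      apply LinearIndependent.of_comp (S.restrictScalars F).subtype
      exact hy.comp (fun l : Fin (Module.finrank K S * D + 1) => (⟨l, by omega⟩ : Fin N))
        (fun l l' h => Fin.ext (by simpa using h))
    have : FiniteDimensional F S := Module.Finite.trans K S
    have h1 := hli.fintype_card_le_finrank
    rw [Fintype.card_fin, ← Module.finrank_mul_finrank F K S, ← hD, mul_comm] at h1
    omega
  choose! pick hpick using key
  set w := greedySeq pick with hw
  have hwk : ∀ k < m, w k ∉ spanLT K w k ∧ ∃ l : Fin N, (l : ℕ) ≤ k * D ∧ w k = y l := by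
    intro k hk
    have hle := finrank_spanLT_le (R := K) w k
    obtain ⟨h1, l, hl, h2⟩ := hpick (spanLT K w k) (by omega)
    rw [hw, greedySeq_eq pick k, ← hw]
    exact ⟨h1, l, hl.trans (Nat.mul_le_mul_right _ hle), h2⟩
  have hsel : ∀ k : Fin m, ∃ l : Fin N, (l : ℕ) ≤ k * D ∧ w k = y l := fun k => (hwk k k.2).2
  choose f hf hfy using hsel
  refine ⟨f, ?_, hf⟩
  have h := linearIndependent_of_notMem_spanLT w m fun k hk => (hwk k hk).1
  convert h using 1
  funext k
  exact (hfy k).symm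

/-- Cut the indices into `m` blocks of length `D`; `r (g i)` is the smallest value in block `i`. -/
theorem prod_pow_le_prod_of_monotone {m D N : ℕ} (hN : m * D = N) {r : Fin N → ℝ}
    (hr : Monotone r) (hr0 : ∀ l, 0 < r l) (g : Fin m → Fin N) (hg : ∀ i, (g i : ℕ) = i * D) :
    (∏ i, r (g i)) ^ D ≤ ∏ l, r l := by
  subst hN
  rw [← finProdFinEquiv.prod_comp, Fintype.prod_prod_type, ← Finset.prod_pow]
  refine Finset.prod_le_prod (fun i _ => pow_nonneg (hr0 _).le _) fun i _ => ?_
  calc r (g i) ^ D = ∏ _s : Fin D, r (g i) := by simp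
    _ ≤ ∏ s : Fin D, r (finProdFinEquiv (i, s)) := by
        refine Finset.prod_le_prod (fun s _ => (hr0 _).le) fun s _ => hr ?_
        rw [Fin.le_def, hg, finProdFinEquiv_apply_val, mul_comm]
        simp

variable (K : Type*) [Field K] [NumberField K]

/-- The index type of a basis of the ring of integers. -/
abbrev IntIdx : Type _ := Module.Free.ChooseBasisIndex ℤ (𝓞 K)

theorem card_intIdx : Fintype.card (IntIdx K) = Module.finrank ℚ K :=
  (Module.finrank_eq_card_basis (NumberField.integralBasis K)).symm

/-- The square of this determinant is the discriminant of the basis. -/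
theorem exists_equiv_embeddings_det_ne_zero :
    ∃ e : IntIdx K ≃ (K →+* ℂ),
      (Matrix.of fun a b => e a (NumberField.integralBasis K b)).det ≠ 0 := by
  have hcard : Fintype.card (IntIdx K) = Fintype.card (K →ₐ[ℚ] ℂ) := by
    rw [card_intIdx, AlgHom.card]
  let e := Fintype.equivOfCardEq hcard
  refine ⟨e.trans (RingHom.equivRatAlgHom K ℂ).symm, ?_⟩
  have h := Algebra.discr_eq_det_embeddingsMatrixReindex_pow_two ℚ ℂ (NumberField.integralBasis K) e
  have h0 := Algebra.discr_not_zero_of_basis ℚ (NumberField.integralBasis K)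
  intro hdet
  rw [← Matrix.det_transpose] at hdet
  have h1 : (Algebra.embeddingsMatrixReindex ℚ ℂ (NumberField.integralBasis K) e).det = 0 := hdet
  rw [h1, zero_pow two_ne_zero, map_eq_zero] at h
  exact h0 h

variable {K}

/-- The matrix of `x ↦ (A_φ (φ x))_φ` in terms of coordinates of `x` in an integral basis. -/
def placeMatrix {m : ℕ} (e : IntIdx K ≃ (K →+* ℂ))
    (A : (K →+* ℂ) → Matrix (Fin m) (Fin m) ℂ) : Matrix (Fin m × IntIdx K) (Fin m × IntIdx K) ℂ :=
  .of fun x y => A (e x.2) x.1 y.1 * e x.2 (NumberField.integralBasis K y.2)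

/-- The matrix factors as the block diagonal of the `A φ` times `1 ⊗ (φ ω_b)`, with `ω_b` the
integral basis. -/
theorem det_placeMatrix {m : ℕ} (e : IntIdx K ≃ (K →+* ℂ))
    (A : (K →+* ℂ) → Matrix (Fin m) (Fin m) ℂ) :
    (placeMatrix e A).det = (∏ φ, (A φ).det) *
      (Matrix.of fun a b => e a (NumberField.integralBasis K b)).det ^ m := by
  classical
  have h : placeMatrix e A = Matrix.blockDiagonal (fun a => A (e a)) *
      ((1 : Matrix (Fin m) (Fin m) ℂ) ⊗ₖ
        (Matrix.of fun a b => e a (NumberField.integralBasis K b))) := by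
    ext ⟨k, a⟩ ⟨k', b⟩
    rw [Matrix.mul_apply, Fintype.sum_prod_type]
    simp [placeMatrix, Matrix.blockDiagonal_apply, Matrix.one_apply]
  rw [h, Matrix.det_mul, Matrix.det_blockDiagonal, Matrix.det_kronecker, Matrix.det_one, one_pow,
    one_mul, Fintype.card_fin, e.prod_comp (fun φ => (A φ).det)]

/-- Conjugation merely permutes the embeddings over which a Gram entry is summed. -/
theorem conj_gram_placeMatrix {m : ℕ} (e : IntIdx K ≃ (K →+* ℂ))
    (A : (K →+* ℂ) → Matrix (Fin m) (Fin m) ℂ)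
    (hA : ∀ φ, A (NumberField.ComplexEmbedding.conjugate φ) = (A φ).map conj)
    (i j : Fin m × IntIdx K) :
    conj (((placeMatrix e A)ᴴ * placeMatrix e A) i j) =
      ((placeMatrix e A)ᴴ * placeMatrix e A) i j := by
  have key : ∀ φ k k' (x : K), conj (A φ k k' * φ x) =
      A (NumberField.ComplexEmbedding.conjugate φ) k k' *
        NumberField.ComplexEmbedding.conjugate φ x := by
    intro φ k k' x
    rw [hA, map_mul]
    rfl
  let τ : (K →+* ℂ) ≃ (K →+* ℂ) :=
    (NumberField.ComplexEmbedding.involutive_conjugate K).toPerm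
  let F : Fin m → (K →+* ℂ) → ℂ := fun k φ =>
    conj (A φ k i.1 * φ (NumberField.integralBasis K i.2)) *
      (A φ k j.1 * φ (NumberField.integralBasis K j.2))
  have hF : ((placeMatrix e A)ᴴ * placeMatrix e A) i j = ∑ k, ∑ φ, F k φ := by
    rw [Matrix.mul_apply, Fintype.sum_prod_type]
    refine Finset.sum_congr rfl fun k _ => ?_
    rw [← e.sum_comp]
    rfl
  rw [hF, map_sum]
  refine Finset.sum_congr rfl fun k _ => ?_
  rw [map_sum, ← τ.sum_comp]
  refine Finset.sum_congr rfl fun φ _ => ?_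
  change conj (F k (NumberField.ComplexEmbedding.conjugate φ)) = F k φ
  simp only [F, ← key, map_mul, Complex.conj_conj]

/-- The vector of algebraic integers with given integral coordinates. -/
def intVec {m : ℕ} (z : Fin m × IntIdx K → ℤ) (k : Fin m) : 𝓞 K :=
  ∑ b, z (k, b) • NumberField.RingOfIntegers.basis K b

theorem coe_intVec {m : ℕ} (z : Fin m × IntIdx K → ℤ) (k : Fin m) :
    (intVec z k : K) = ∑ b, (z (k, b) : ℚ) • NumberField.integralBasis K b := by
  change algebraMap (𝓞 K) K (intVec z k) = _
  rw [intVec, map_sum]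
  refine Finset.sum_congr rfl fun b _ => ?_
  rw [NumberField.integralBasis_apply, map_zsmul, Int.cast_smul_eq_zsmul]

theorem placeMatrix_mulVec {m : ℕ} (e : IntIdx K ≃ (K →+* ℂ))
    (A : (K →+* ℂ) → Matrix (Fin m) (Fin m) ℂ) (z : Fin m × IntIdx K → ℤ) (k : Fin m)
    (a : IntIdx K) :
    (placeMatrix e A *ᵥ fun y => (z y : ℂ)) (k, a) =
      (A (e a) *ᵥ fun k' => e a (intVec z k')) k := by
  simp only [Matrix.mulVec, dotProduct, placeMatrix, Matrix.of_apply, Fintype.sum_prod_type,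
    coe_intVec, map_sum, Finset.mul_sum, Rat.smul_def, map_mul]
  refine Finset.sum_congr rfl fun k' _ => Finset.sum_congr rfl fun b _ => ?_
  simp
  ring

theorem linearIndependent_intVec {m N : ℕ} (z : Fin N → Fin m × IntIdx K → ℤ)
    (hz : LinearIndependent ℝ (fun l i => (z l i : ℝ))) :
    LinearIndependent ℚ (fun l k => (intVec (z l) k : K)) := by
  have h1 : LinearIndependent ℚ (fun l i => (z l i : ℝ)) :=
    hz.restrict_scalars (by
      intro x y h
      simpa [Rat.smul_def] using h)
  let ι₁ : (Fin m × IntIdx K → ℚ) →ₗ[ℚ] (Fin m × IntIdx K → ℝ) :=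
    LinearMap.pi fun i => (Algebra.linearMap ℚ ℝ) ∘ₗ LinearMap.proj i
  have h2 : LinearIndependent ℚ (fun l i => (z l i : ℚ)) := by
    apply LinearIndependent.of_comp ι₁
    convert h1 using 1
    ext l i
    simp [ι₁]
  let Φ : (Fin m × IntIdx K → ℚ) →ₗ[ℚ] (Fin m → K) :=
    LinearMap.pi fun k => ∑ b, (LinearMap.proj (k, b)).smulRight (NumberField.integralBasis K b)
  have hΦ : ∀ q k, Φ q k = ∑ b, q (k, b) • NumberField.integralBasis K b := by
    intro q k
    simp [Φ]
  have hker : LinearMap.ker Φ = ⊥ := by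
    rw [LinearMap.ker_eq_bot']
    intro q hq
    ext ⟨k, b⟩
    have h := congrFun hq k
    rw [hΦ] at h
    exact Fintype.linearIndependent_iff.mp (NumberField.integralBasis K).linearIndependent
      (fun b => q (k, b)) h b
  have h3 : (fun l k => (intVec (z l) k : K)) = ⇑Φ ∘ fun l i => (z l i : ℚ) := by
    ext l k
    simp only [Function.comp, hΦ, coe_intVec]
  rw [h3]
  exact h2.map' Φ hker

variable (K)

/-- Minkowski's second theorem over a number field: for any normalized family of matrices at the
embeddings of `K`, there is a basis of `K^m` made of integral vectors of small norms. -/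
theorem exists_integral_basis_prod_le (m : ℕ) :
    ∃ C : ℝ, ∀ A : (K →+* ℂ) → Matrix (Fin m) (Fin m) ℂ,
      (∀ φ, A (NumberField.ComplexEmbedding.conjugate φ) = (A φ).map conj) →
      (∀ φ, ‖(A φ).det‖ = 1) →
      ∃ (x : Fin m → Fin m → 𝓞 K) (a : Fin m → ℝ),
        LinearIndependent K (fun i k => (x i k : K)) ∧ Monotone a ∧ (∀ i, 0 < a i) ∧
        (∀ i φ k, ‖(A φ *ᵥ fun k' => φ (x i k')) k‖ ≤ a i) ∧ ∏ i, a i ≤ C := by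
  obtain ⟨e, he⟩ := exists_equiv_embeddings_det_ne_zero K
  set D := Module.finrank ℚ K
  have hDpos : 0 < D := Module.finrank_pos
  obtain ⟨C, hC0, hC⟩ := exists_int_linearIndependent_prod_le (ι := Fin m × IntIdx K) (N := m * D)
    (by rw [Fintype.card_prod, Fintype.card_fin, card_intIdx])
  set δ := ‖(Matrix.of fun a b => e a (NumberField.integralBasis K b)).det‖ ^ m with hδ
  -- What is bounded by `C * δ` is the `D`-th power of `∏ a i`; the maximum with `1` avoids taking a
  -- root.
  refine ⟨max 1 (C * δ), fun A hA hdet => ?_⟩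
  have hnorm : ‖(placeMatrix e A).det‖ = δ := by
    rw [det_placeMatrix, norm_mul, norm_prod, Finset.prod_congr rfl fun φ _ => hdet φ,
      Finset.prod_const_one, one_mul, norm_pow]
  have hne : (placeMatrix e A).det ≠ 0 := by
    rw [← norm_ne_zero_iff, hnorm]
    exact pow_ne_zero _ (norm_ne_zero_iff.mpr he)
  obtain ⟨z, r, hzli, hrmono, hrpos, hbd, hprod⟩ := hC _ hne (conj_gram_placeMatrix e A hA)
  obtain ⟨f, hf, hfle⟩ := exists_linearIndependent_subfamily (F := ℚ) (K := K) (V := Fin m → K)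
    (m := m) rfl _ (linearIndependent_intVec z hzli)
  have hlt : ∀ i : Fin m, (i : ℕ) * D < m * D := fun i => (Nat.mul_lt_mul_right hDpos).mpr i.2
  let g : Fin m → Fin (m * D) := fun i => ⟨i * D, hlt i⟩
  refine ⟨fun i => intVec (z (f i)), fun i => r (g i), hf, fun i i' h => hrmono ?_,
    fun i => hrpos _, fun i φ k => ?_, ?_⟩
  · exact Nat.mul_le_mul_right _ h
  · obtain ⟨b, rfl⟩ := e.surjective φ
    rw [← placeMatrix_mulVec]
    exact (hbd _ _).trans (hrmono (hfle i))
  · have h1 := prod_pow_le_prod_of_monotone rfl hrmono hrpos g (fun i => rfl)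
    rw [hnorm] at hprod
    rw [le_max_iff]
    by_contra! h
    have h2 := le_self_pow₀ h.1.le hDpos.ne'
    linarith [h.2]

end NumberFieldMinima

/-! ### Heights of subspaces spanned by integral points -/

section HeightBound

theorem wedgeCoord_map {R S : Type*} [CommRing R] [CommRing S] (f : R →+* S) {d m : ℕ}
    (X : Fin d → Fin m → R) (s : Set.powersetCard (Fin m) d) :
    wedgeCoord (fun i k => f (X i k)) s = f (wedgeCoord X s) := by
  rw [wedgeCoord_eq_det, wedgeCoord_eq_det, RingHom.map_det]
  rfl

theorem wedgeNorm_map {𝕜 𝕜' : Type*} [RCLike 𝕜] [RCLike 𝕜'] (f : 𝕜 →+* 𝕜')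
    (hf : ∀ z, ‖f z‖ = ‖z‖) {d m : ℕ} (X : Fin d → Fin m → 𝕜) :
    wedgeNorm (fun i k => f (X i k)) = wedgeNorm X := by
  simp only [wedgeNorm, wedgeCoord_map, hf]

variable {K : Type*} [Field K] [NumberField K] {d m : ℕ}

theorem minorIdeal_le_one (x : Fin d → Fin m → 𝓞 K) :
    minorIdeal (fun i k => (x i k : K)) ≤ 1 := by
  rw [← FractionalIdeal.coe_le_coe, minorIdeal, FractionalIdeal.spanFinset_coe, Submodule.span_le]
  rintro _ ⟨s, -, rfl⟩
  change wedgeCoord (fun i k => algebraMap (𝓞 K) K (x i k)) s ∈ _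
  rw [wedgeCoord_map, SetLike.mem_coe, FractionalIdeal.mem_coe, FractionalIdeal.mem_one_iff]
  exact ⟨_, rfl⟩

/-- Integral minors generate an integral ideal, whose norm is a natural number, so its inverse is at
most `1` (also for norm `0`, as `0⁻¹ = 0`). -/
theorem heightOfFamily_le_prod (x : Fin d → Fin m → 𝓞 K) :
    heightOfFamily (fun i k => (x i k : K)) ≤
      ∏ φ : K →+* ℂ, wedgeNorm (fun i k => φ (x i k)) := by
  obtain ⟨I, hI⟩ := FractionalIdeal.le_one_iff_exists_coeIdeal.mp (minorIdeal_le_one x)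
  rw [heightOfFamily, ← hI, FractionalIdeal.coeIdeal_absNorm]
  refine mul_le_of_le_one_left (Finset.prod_nonneg fun φ _ => wedgeNorm_nonneg _) ?_
  simpa using Nat.cast_inv_le_one (α := ℝ) (Ideal.absNorm I)

end HeightBound

section RationalPoints

variable {K : Type*} [Field K] {𝕜 : Type*} [RCLike 𝕜] (σ : K →+* 𝕜) {m : ℕ}

theorem linearIndependent_embedVec (x : Fin m → Fin m → K) (hx : LinearIndependent K x) :
    LinearIndependent 𝕜 (fun i => embedVec σ (x i)) := by
  have h1 : IsUnit (Matrix.of x) := Matrix.linearIndependent_rows_iff_isUnit.mp hx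
  have h2 : IsUnit (σ.mapMatrix (Matrix.of x)) := h1.map _
  have h3 := Matrix.linearIndependent_rows_iff_isUnit.mpr h2
  exact h3.map' (WithLp.linearEquiv 2 𝕜 (Fin m → 𝕜)).symm.toLinearMap (LinearEquiv.ker _)

variable [NumberField K]

/-- Completing to a basis of `K^m`, the coordinates of a `K`-rational vector over `𝕜` are the images
under `σ` of those over `K`, so the same ones vanish. -/
theorem rationalPoints_span (x : Fin m → Fin m → K) (hx : LinearIndependent K x) {d : ℕ}
    (f : Fin d → Fin m) :
    rationalPoints σ (Submodule.span 𝕜 (Set.range fun i => embedVec σ (x (f i)))) =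
      Submodule.span K (Set.range fun i => x (f i)) := by
  have hσ := linearIndependent_embedVec σ x hx
  apply le_antisymm
  · intro y hy
    let b : Module.Basis (Fin m) K (Fin m → K) :=
      .mk hx (hx.span_eq_top_of_card_eq_finrank' (by simp)).ge
    let B : Module.Basis (Fin m) 𝕜 (EuclideanSpace 𝕜 (Fin m)) :=
      .mk hσ (hσ.span_eq_top_of_card_eq_finrank' (by simp)).ge
    have hrangeB : (Set.range fun i => embedVec σ (x (f i))) = B '' Set.range f := by
      rw [← Set.range_comp]
      simp [B, Function.comp_def]
    have hrangeb : (Set.range fun i => x (f i)) = b '' Set.range f := by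
      rw [← Set.range_comp]
      simp [b, Function.comp_def]
    have hrepr : ∀ i, B.repr (embedVec σ y) i = σ (b.repr y i) := by
      intro i
      have h : embedVec σ y = ∑ l, σ (b.repr y l) • B l := by
        conv_lhs => rw [← b.sum_repr y]
        ext k
        simp [embedVec, B, b, WithLp.ofLp_sum, Finset.sum_apply]
      rw [h, B.repr_sum_self]
    have hy' : embedVec σ y ∈ Submodule.span 𝕜 (B '' Set.range f) := by
      rw [← hrangeB]; exact hy
    rw [hrangeb, b.mem_span_image]
    rw [B.mem_span_image] at hy'
    refine subset_trans (fun i hi => ?_) hy'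
    rw [Finset.mem_coe, Finsupp.mem_support_iff] at hi ⊢
    rw [hrepr]
    simpa using hi
  · rw [Submodule.span_le]
    rintro _ ⟨i, rfl⟩
    exact Submodule.subset_span ⟨i, rfl⟩

theorem heightOver_span (x : Fin m → Fin m → K) (hx : LinearIndependent K x) {d : ℕ}
    (f : Fin d → Fin m) (hf : Function.Injective f) :
    heightOver σ (Submodule.span 𝕜 (Set.range fun i => embedVec σ (x (f i)))) =
      heightOfFamily (fun i => x (f i)) := by
  rw [heightOver, rationalPoints_span σ x hx]
  refine (height_eq_heightOfFamily _ (Module.Basis.span (hx.comp f hf))).trans ?_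
  congr 1
  funext i
  exact congrArg Subtype.val (Module.Basis.span_apply (hx.comp f hf) i)

end RationalPoints

/-! ### The matrix contracting towards a line -/

section LineMatrix

open Matrix

variable {𝕜 : Type*} [RCLike 𝕜] {m : ℕ}

/-- In the coordinates `x k₀`, `x k - x k₀ * v k`, multiplication by `r` and by `s`. -/
def lineMatrix (k₀ : Fin m) (v : Fin m → 𝕜) (r s : ℝ) : Matrix (Fin m) (Fin m) 𝕜 :=
  diagonal (fun k => if k = k₀ then (r : 𝕜) else (s : 𝕜)) *
    (1 + replicateCol Unit (Pi.single k₀ 1 - v) * replicateRow Unit (Pi.single k₀ (1 : 𝕜)))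

theorem det_lineMatrix (k₀ : Fin m) (v : Fin m → 𝕜) (hv : v k₀ = 1) (r s : ℝ) :
    (lineMatrix k₀ v r s).det = r * s ^ (m - 1) := by
  rw [lineMatrix, det_mul, det_diagonal, det_one_add_replicateCol_mul_replicateRow,
    single_one_dotProduct, Pi.sub_apply, Pi.single_eq_same, hv, sub_self, add_zero, mul_one,
    ← Finset.mul_prod_erase _ _ (Finset.mem_univ k₀), if_pos rfl]
  rw [Finset.prod_congr (g := fun _ => (s : 𝕜)) rfl
      (fun i hi => by rw [if_neg (Finset.ne_of_mem_erase hi)])]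
  simp

theorem lineMatrix_mulVec (k₀ : Fin m) (v : Fin m → 𝕜) (r s : ℝ) (x : Fin m → 𝕜) (k : Fin m) :
    (lineMatrix k₀ v r s *ᵥ x) k = (if k = k₀ then (r : 𝕜) else (s : 𝕜)) *
      (x k + x k₀ * ((Pi.single k₀ 1 : Fin m → 𝕜) k - v k)) := by
  rw [lineMatrix, ← mulVec_mulVec, mulVec_diagonal, add_mulVec, one_mulVec]
  congr 1
  simp [mulVec, dotProduct, Matrix.mul_apply, Pi.single_apply, mul_comm]

end LineMatrix

/-! ### Subspaces close to a given vector -/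

section Approximation

open Matrix NumberField.ComplexEmbedding
open scoped ComplexConjugate

/-- Either all omitted factors are at least `1`, or one is below `1` and then, by monotonicity, so
are all the retained ones. -/
theorem prod_castLE_le {d m : ℕ} (h : d ≤ m) {a : Fin m → ℝ} (ha : Monotone a)
    (ha0 : ∀ i, 0 < a i) {C : ℝ} (hC : ∏ i, a i ≤ C) :
    ∏ i : Fin d, a (Fin.castLE h i) ≤ max 1 C := by
  obtain ⟨e, rfl⟩ := Nat.exists_eq_add_of_le h
  have hcast : ∏ i : Fin d, a (Fin.castLE h i) = ∏ i : Fin d, a (Fin.castAdd e i) := rfl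
  rw [hcast]
  by_cases h1 : ∀ i : Fin e, 1 ≤ a (Fin.natAdd d i)
  · refine le_trans ?_ (hC.trans (le_max_right _ _))
    rw [Fin.prod_univ_add]
    refine le_mul_of_one_le_right (Finset.prod_nonneg fun i _ => (ha0 _).le) ?_
    simpa using Finset.prod_le_prod (s := Finset.univ) (f := fun _ : Fin e => (1 : ℝ))
      (fun i _ => zero_le_one) (fun i _ => h1 i)
  · push Not at h1
    obtain ⟨l, hl⟩ := h1
    refine le_trans (Finset.prod_le_one (fun i _ => (ha0 _).le) fun i _ => ?_) (le_max_left _ _)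
    refine (ha ?_).trans hl.le
    rw [Fin.le_def, Fin.val_castAdd, Fin.val_natAdd]
    omega

theorem prod_le_pow_mul_pow {α : Type*} [Fintype α] [DecidableEq α] (s : Finset α) {w : α → ℝ}
    {B E : ℝ} (hw : ∀ x, 0 ≤ w x) (hs : ∀ x ∈ s, w x ≤ B * E) (hs' : ∀ x ∉ s, w x ≤ B) :
    ∏ x, w x ≤ B ^ Fintype.card α * E ^ s.card := by
  calc ∏ x, w x ≤ ∏ x, B * (if x ∈ s then E else 1) := by
        refine Finset.prod_le_prod (fun x _ => hw x) fun x _ => ?_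
        split_ifs with h
        · exact hs x h
        · simpa using hs' x h
    _ = B ^ Fintype.card α * E ^ s.card := by
        rw [Finset.prod_mul_distrib, Finset.prod_const, Finset.card_univ, Finset.prod_ite_mem,
          Finset.univ_inter, Finset.prod_const]

variable {K : Type*} [Field K]

/-- The matrix `A` at the embedding `φ₀`, its conjugate at the conjugate embedding, and the
identity elsewhere. -/
def familyAt {m : ℕ} (φ₀ : K →+* ℂ) (A : Matrix (Fin m) (Fin m) ℂ) (φ : K →+* ℂ) :
    Matrix (Fin m) (Fin m) ℂ :=
  open scoped Classical in
  if φ = φ₀ then A else if φ = conjugate φ₀ then A.map conj else 1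

theorem familyAt_self {m : ℕ} (φ₀ : K →+* ℂ) (A : Matrix (Fin m) (Fin m) ℂ) :
    familyAt φ₀ A φ₀ = A := if_pos rfl

theorem familyAt_of_ne {m : ℕ} {φ₀ φ : K →+* ℂ} (A : Matrix (Fin m) (Fin m) ℂ) (h : φ ≠ φ₀)
    (h' : φ ≠ conjugate φ₀) : familyAt φ₀ A φ = 1 := by
  rw [familyAt, if_neg h, if_neg h']

/-- When `φ₀` is real the first two branches of `familyAt` overlap, whence the condition that `A` be
real. -/
theorem familyAt_conjugate {m : ℕ} (φ₀ : K →+* ℂ) (A : Matrix (Fin m) (Fin m) ℂ)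
    (hA : conjugate φ₀ = φ₀ → A.map conj = A) (φ : K →+* ℂ) :
    familyAt φ₀ A (conjugate φ) = (familyAt φ₀ A φ).map conj := by
  have hinv := NumberField.ComplexEmbedding.involutive_conjugate K
  by_cases h1 : φ = φ₀
  · subst h1
    rw [familyAt_self]
    by_cases h2 : conjugate φ = φ
    · rw [h2, familyAt_self, hA h2]
    · rw [familyAt, if_neg h2, if_pos rfl]
  · by_cases h2 : φ = conjugate φ₀
    · have h3 : conjugate φ = φ₀ := by rw [h2, hinv]
      rw [h3, familyAt_self, familyAt, if_neg h1, if_pos h2]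
      ext
      simp
    · rw [familyAt_of_ne A h1 h2, familyAt_of_ne]
      · ext i k
        by_cases hik : i = k <;> simp [Matrix.one_apply, hik]
      · intro h; exact h2 (by rw [← h, hinv])
      · intro h; exact h1 (hinv.injective h)

theorem norm_det_familyAt {m : ℕ} (φ₀ : K →+* ℂ) (A : Matrix (Fin m) (Fin m) ℂ)
    (hA : ‖A.det‖ = 1) (φ : K →+* ℂ) : ‖(familyAt φ₀ A φ).det‖ = 1 := by
  unfold familyAt
  split_ifs
  · exact hA
  · have h : (A.map conj).det = conj A.det := (RingHom.map_det (starRingEnd ℂ) A).symm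
    rw [h, RCLike.norm_conj, hA]
  · simp

variable [NumberField K] {𝕜 : Type*} [RCLike 𝕜]

open scoped Classical in
/-- Subspaces defined over `K` near a vector `u`, from Minkowski's second theorem. -/
theorem exists_subspace_near (σ : K →+* 𝕜) (f : 𝕜 →+* ℂ) (hf : ∀ z, ‖f z‖ = ‖z‖)
    (hreal : conjugate (f.comp σ) = f.comp σ → ∀ z, conj (f z) = f z) {n j : ℕ} (hj : j + 1 ≤ n)
    {u : EuclideanSpace 𝕜 (Fin (n + 1))} (hu : u ≠ 0) {q : ℕ}
    (hq : ({f.comp σ, conjugate (f.comp σ)} : Finset (K →+* ℂ)).card = q) :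
    ∃ C : ℝ, 0 < C ∧ ∀ t : ℝ, 0 ≤ t → ∃ S : Submodule 𝕜 (EuclideanSpace 𝕜 (Fin (n + 1))),
      IsDefinedOver σ S ∧ Module.finrank 𝕜 S = j + 1 ∧
      heightOver σ S ≤ C * Real.exp ((n - j) * t) ^ q ∧
      heightOver σ S * omegaI 1 (Submodule.span 𝕜 {u}) S ^ q ≤
        C * Real.exp (-(j + 1) * t) ^ q := by
  obtain ⟨k₀, hk₀⟩ : ∃ k, u k ≠ 0 := by
    by_contra! h
    exact hu (by ext k; simpa using h k)
  set φ₀ := f.comp σ with hφ₀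
  obtain ⟨C₀, hC₀⟩ := exists_integral_basis_prod_le K (n + 1)
  let v : Fin (n + 1) → 𝕜 := fun k => u k / u k₀
  have hv : v k₀ = 1 := div_self hk₀
  have huv : ∀ k, u k₀ * v k = u k := fun k => mul_div_cancel₀ _ hk₀
  set U : ℝ := 1 + ∑ k, ‖v k‖ with hU
  have hU1 : 1 ≤ U := le_add_of_nonneg_right (Finset.sum_nonneg fun _ _ => norm_nonneg _)
  have hvU : ∀ k, ‖v k‖ ≤ U := fun k =>
    (Finset.single_le_sum (f := fun k => ‖v k‖) (fun _ _ => norm_nonneg _)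
      (Finset.mem_univ k)).trans (le_add_of_nonneg_left zero_le_one)
  set M : ℝ := max 1 C₀ with hM
  have hM0 : 0 ≤ M := zero_le_one.trans (le_max_left _ _)
  set B₁ : ℝ := wedgeDim (j + 1) (n + 1) * ((j + 1).factorial * (2 ^ (j + 1) * U * M)) with hB₁
  set B₂ : ℝ := angleConst (j + 1) (n + 1) ‖u‖ ‖u‖ * M with hB₂
  set B : ℝ := max (max B₁ B₂) 1 with hB
  have hB₁B : B₁ ≤ B := (le_max_left _ _).trans (le_max_left _ _)
  have hB₂B : B₂ ≤ B := (le_max_right _ _).trans (le_max_left _ _)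
  have hB1 : 1 ≤ B := le_max_right _ _
  refine ⟨B ^ Fintype.card (K →+* ℂ), by positivity, fun t ht => ?_⟩
  -- One factor `exp (-(n t))` against `n` factors `exp t`: the determinant is `1`.
  set L : Matrix (Fin (n + 1)) (Fin (n + 1)) 𝕜 :=
    lineMatrix k₀ v (Real.exp (-(n * t))) (Real.exp t) with hL
  have hLdet : ‖(L.map f).det‖ = 1 := by
    have h : (L.map f).det = f L.det := (RingHom.map_det f L).symm
    rw [h, hf, hL, det_lineMatrix k₀ v hv, norm_mul, norm_pow, RCLike.norm_ofReal,
      RCLike.norm_ofReal, Real.abs_exp, Real.abs_exp, Nat.add_sub_cancel, ← Real.exp_nat_mul,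
      ← Real.exp_add, neg_add_cancel, Real.exp_zero]
  obtain ⟨x, a, hx, hamono, ha, hbd, hprod⟩ := hC₀ (familyAt φ₀ (L.map f))
    (familyAt_conjugate φ₀ _ fun h => by ext i k; exact hreal h _)
    (norm_det_familyAt φ₀ _ hLdet)
  have hd : j + 1 ≤ n + 1 := by omega
  let g : Fin (j + 1) → Fin (n + 1) := Fin.castLE hd
  have hg : Function.Injective g := Fin.castLE_injective hd
  set P : ℝ := ∏ i, a (g i) with hP
  have hP0 : 0 ≤ P := Finset.prod_nonneg fun i _ => (ha _).le
  have hPM : P ≤ M := prod_castLE_le hd hamono ha hprod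
  let X : Fin (j + 1) → Fin (n + 1) → 𝕜 := fun i k => σ (x (g i) k)
  have hLbd : ∀ i k, ‖(L *ᵥ fun k' => σ (x i k')) k‖ ≤ a i := by
    intro i k
    have h := hbd i φ₀ k
    rw [familyAt_self] at h
    rw [← hf, RingHom.map_mulVec]
    exact h
  have hX₀ : ∀ i, ‖X i k₀‖ ≤ Real.exp (n * t) * a (g i) := by
    intro i
    have h := hLbd (g i) k₀
    rw [hL, lineMatrix_mulVec, if_pos rfl, hv, Pi.single_eq_same, sub_self, mul_zero, add_zero,
      norm_mul, RCLike.norm_ofReal, Real.abs_exp, Real.exp_neg,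
      inv_mul_le_iff₀ (Real.exp_pos _)] at h
    exact h
  let p : Fin (j + 1) → Fin (n + 1) → 𝕜 := fun i k => X i k - X i k₀ * v k
  have hp : ∀ i k, ‖p i k‖ ≤ Real.exp (-t) * a (g i) := by
    intro i k
    by_cases hk : k = k₀
    · subst hk
      have := ha (g i)
      simp only [p, hv, mul_one, sub_self, norm_zero]
      positivity
    · have h := hLbd (g i) k
      rw [hL, lineMatrix_mulVec, if_neg hk, Pi.single_eq_of_ne hk, zero_sub, mul_neg,
        ← sub_eq_add_neg, norm_mul, RCLike.norm_ofReal, Real.abs_exp] at h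
      rw [Real.exp_neg, inv_mul_eq_div, le_div_iff₀ (Real.exp_pos _), mul_comm]
      exact h
  have hXv : ∀ i k, X i k = X i k₀ * v k + p i k := fun i k => by simp [p]
  have hXu : ∀ i k, X i k = X i k₀ / u k₀ * u k + p i k := fun i k => by
    rw [hXv, ← huv k]
    field_simp
  set W : ℝ := wedgeNorm X with hW
  have hWle : W ≤ B * Real.exp ((n - j) * t) := by
    have h := wedgeNorm_le_of_near_line (Nat.add_one_pos j) X v (fun i => X i k₀) p (fun i => a (g i))
      (fun i => ha _) hU1 (Real.exp_pos (-t)).le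
      (Real.exp_le_exp.mpr (by nlinarith [(Nat.cast_nonneg n : (0 : ℝ) ≤ n)])) hXv hvU hX₀ hp
    rw [Nat.add_sub_cancel, ← Real.exp_nat_mul] at h
    have hE : Real.exp (n * t) * Real.exp (j * -t) = Real.exp ((n - j) * t) := by
      rw [← Real.exp_add]; congr 1; ring
    calc W ≤ _ := h
      _ = wedgeDim (j + 1) (n + 1) * ((j + 1).factorial * (2 ^ (j + 1) * U * P)) *
          (Real.exp (n * t) * Real.exp (j * -t)) := by simp only [hP]; ring
      _ ≤ B * Real.exp ((n - j) * t) := by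
        rw [hE]
        gcongr
        refine le_trans ?_ hB₁B
        rw [hB₁]
        gcongr
  set S : Submodule 𝕜 (EuclideanSpace 𝕜 (Fin (n + 1))) :=
    Submodule.span 𝕜 (Set.range fun i => embedVec σ (fun k => (x (g i) k : K))) with hS
  have hli := (linearIndependent_embedVec σ _ hx).comp g hg
  have hrank : Module.finrank 𝕜 S = j + 1 :=
    (finrank_span_eq_card hli).trans (Fintype.card_fin _)
  have hS0 : S ≠ ⊥ := by
    intro h
    rw [h, finrank_bot] at hrank
    omega
  set ω := omegaI 1 (Submodule.span 𝕜 {u}) S with hω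
  have hω0 : 0 ≤ ω := omegaI_nonneg _ _ _
  have hWω : W * ω ≤ B * Real.exp (-(j + 1) * t) := by
    have h := wedgeNorm_mul_omegaI_le X hu (fun i => X i k₀ / u k₀) p (fun i => a (g i))
      (fun i => ha _) (norm_nonneg u) (Real.exp_pos (-t)).le hXu (fun k => PiLp.norm_apply_le u k)
      hp (S := S) (fun i => Submodule.subset_span ⟨i, rfl⟩) hS0
    have hE : Real.exp (-t) ^ (j + 1) = Real.exp (-(j + 1) * t) := by
      rw [← Real.exp_nat_mul]; congr 1; push_cast; ring
    rw [hE] at h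
    calc W * ω ≤ _ := h
      _ = angleConst (j + 1) (n + 1) ‖u‖ ‖u‖ * P * Real.exp (-(j + 1) * t) := by
        simp only [hP]; ring
      _ ≤ B * Real.exp (-(j + 1) * t) := by
        gcongr
        refine le_trans ?_ hB₂B
        rw [hB₂]
        have := angleConst_nonneg (d := j + 1) (m := n + 1) (norm_nonneg u) (norm_nonneg u)
        gcongr
  let w : (K →+* ℂ) → ℝ := fun φ => wedgeNorm (fun i k => φ (x (g i) k))
  have hw0 : ∀ φ, 0 ≤ w φ := fun φ => wedgeNorm_nonneg _
  have hwIn : ∀ φ ∈ ({φ₀, conjugate φ₀} : Finset (K →+* ℂ)), w φ = W := by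
    intro φ hφ
    have h0 : w φ₀ = W := wedgeNorm_map f hf X
    rcases Finset.mem_insert.mp hφ with rfl | hφ
    · exact h0
    · rw [Finset.mem_singleton.mp hφ, ← h0]
      exact wedgeNorm_map (starRingEnd ℂ) (fun z => RCLike.norm_conj z)
        (fun i k => φ₀ (x (g i) k))
  have hwOut : ∀ φ ∉ ({φ₀, conjugate φ₀} : Finset (K →+* ℂ)), w φ ≤ B := by
    intro φ hφ
    simp only [Finset.mem_insert, Finset.mem_singleton, not_or] at hφ
    have h := wedgeNorm_le_of_entry_le (fun i k => φ (x (g i) k)) (fun i => a (g i))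
      (fun i => (ha _).le) (fun i k => by
        have h := hbd (g i) φ k
        rwa [familyAt_of_ne _ hφ.1 hφ.2, Matrix.one_mulVec] at h)
    refine h.trans (le_trans ?_ hB₁B)
    rw [hB₁]
    gcongr
    refine hPM.trans (le_mul_of_one_le_left hM0 ?_)
    exact one_le_mul_of_one_le_of_one_le (one_le_pow₀ one_le_two) hU1
  have hheight : heightOver σ S ≤ ∏ φ, w φ := by
    rw [hS, heightOver_span σ (fun i k => (x i k : K)) hx g hg]
    exact heightOfFamily_le_prod fun i => x (g i)
  refine ⟨S, ⟨Set.range fun i k => (x (g i) k : K), ?_⟩, hrank, ?_, ?_⟩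
  · rw [← Set.range_comp]; rfl
  · refine hheight.trans ?_
    rw [← hq]
    exact prod_le_pow_mul_pow _ hw0 (fun φ hφ => (hwIn φ hφ).trans_le hWle) hwOut
  -- Distribute `ω ^ q` as one factor `ω` at each of the `q` embeddings where the wedge norm is `W`.
  · have h1 : heightOver σ S * ω ^ q ≤
        ∏ φ, w φ * (if φ ∈ ({φ₀, conjugate φ₀} : Finset (K →+* ℂ)) then ω else 1) := by
      rw [Finset.prod_mul_distrib, Finset.prod_ite_mem, Finset.univ_inter, Finset.prod_const, hq]
      gcongr
    refine h1.trans ?_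
    rw [← hq]
    refine prod_le_pow_mul_pow _ (fun φ => mul_nonneg (hw0 φ) ?_) (fun φ hφ => ?_) (fun φ hφ => ?_)
    · split_ifs
      · exact hω0
      · exact zero_le_one
    · rw [if_pos hφ, hwIn φ hφ]
      exact hWω
    · rw [if_neg hφ, mul_one]
      exact hwOut φ hφ

/-- Turning estimates in terms of a parameter `t` into a statement for all large `Q`. -/
theorem eventually_hasApprox {σ : K →+* 𝕜} {n j q : ℕ} (hj : j + 1 ≤ n) (hq : 0 < q)
    {u : EuclideanSpace 𝕜 (Fin (n + 1))} {C : ℝ} (hC : 0 < C)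
    (h : ∀ t : ℝ, 0 ≤ t → ∃ S : Submodule 𝕜 (EuclideanSpace 𝕜 (Fin (n + 1))),
      IsDefinedOver σ S ∧ Module.finrank 𝕜 S = j + 1 ∧
      heightOver σ S ≤ C * Real.exp ((n - j) * t) ^ q ∧
      heightOver σ S * omegaI 1 (Submodule.span 𝕜 {u}) S ^ q ≤
        C * Real.exp (-(j + 1) * t) ^ q)
    {w : ℝ} (hw : w < ((j : ℝ) + 1) / (n - j)) :
    ∀ᶠ Q : ℝ in atTop, HasApprox σ q j u w Q := by
  set κ : ℝ := ((j : ℝ) + 1) / (n - j) with hκ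
  have hnj : (0 : ℝ) < n - j := by
    have : (j : ℝ) + 1 ≤ n := by exact_mod_cast hj
    linarith
  have hq' : (0 : ℝ) < q := by exact_mod_cast hq
  -- The gap `κ - w > 0` lets `Q ^ (κ - w)` absorb the constant `C ^ (1 + κ)`.
  filter_upwards [eventually_ge_atTop C, (tendsto_rpow_atTop (sub_pos.mpr hw)).eventually_ge_atTop
    (C * C ^ κ)] with Q hQC hQ
  have hQ0 : 0 < Q := hC.trans_le hQC
  -- The solution of `C * exp (q (n - j) t) = Q`.
  set t : ℝ := Real.log (Q / C) / (q * (n - j)) with ht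
  have hQC0 : 0 < Q / C := by positivity
  have ht0 : 0 ≤ t := div_nonneg (Real.log_nonneg (by rwa [le_div_iff₀ hC, one_mul])) (by positivity)
  obtain ⟨S, hS, hrank, h1, h2⟩ := h t ht0
  refine ⟨S, hS, hrank, h1.trans (le_of_eq ?_), h2.trans ?_⟩
  · rw [← Real.exp_nat_mul]
    have : (q : ℝ) * ((n - j) * t) = Real.log (Q / C) := by
      rw [ht]; field_simp
    rw [this, Real.exp_log hQC0]
    field_simp
  · rw [← Real.exp_nat_mul]
    have h3 : (q : ℝ) * (-(j + 1) * t) = Real.log (Q / C) * -κ := by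
      rw [ht, hκ]; field_simp
    rw [h3, ← Real.rpow_def_of_pos hQC0, Real.div_rpow hQ0.le hC.le, Real.rpow_neg hC.le,
      div_inv_eq_mul, mul_comm (Q ^ (-κ)), ← mul_assoc]
    calc C * C ^ κ * Q ^ (-κ) ≤ Q ^ (κ - w) * Q ^ (-κ) := by gcongr
      _ = Q ^ (-w) := by
        rw [← Real.rpow_add hQ0]
        congr 1
        ring

theorem unifExponent_le_ordExponent {m : ℕ} (σ : K →+* 𝕜) (q j : ℕ)
    (u : EuclideanSpace 𝕜 (Fin m)) : unifExponent σ q j u ≤ ordExponent σ q j u :=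
  sSup_le_sSup (Set.image_mono fun _ h => Eventually.frequently h)

-- Here `f` is the inclusion `ℝ → ℂ` or the identity of `ℂ`, and `q` counts the distinct embeddings
-- among `f ∘ σ` and its conjugate; this treats both cases together.
open scoped Classical in
theorem le_unifExponent (σ : K →+* 𝕜) (f : 𝕜 →+* ℂ) (hf : ∀ z, ‖f z‖ = ‖z‖)
    (hreal : conjugate (f.comp σ) = f.comp σ → ∀ z, conj (f z) = f z) {n j : ℕ} (hj : j + 1 ≤ n)
    {u : EuclideanSpace 𝕜 (Fin (n + 1))} (hu : u ≠ 0) {q : ℕ}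
    (hq : ({f.comp σ, conjugate (f.comp σ)} : Finset (K →+* ℂ)).card = q) :
    ((((j : ℝ) + 1) / ((n : ℝ) - (j : ℝ)) : ℝ) : EReal) ≤ unifExponent σ q j u := by
  obtain ⟨C, hC, h⟩ := exists_subspace_near σ f hf hreal hj hu hq
  have hq0 : 0 < q := by rw [← hq]; exact Finset.card_pos.mpr (Finset.insert_nonempty _ _)
  refine le_of_forall_lt fun c hc => ?_
  obtain ⟨w, hcw, hw⟩ := EReal.lt_iff_exists_real_btwn.mp hc
  refine hcw.trans_le (le_sSup ⟨w, ?_, rfl⟩)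
  exact eventually_hasApprox hj hq0 hC h (EReal.coe_lt_coe_iff.mp hw)

end Approximation

end SchmidtApprox

end

theorem mainTheorem2 {K : Type*} [Field K] [NumberField K] (n j : ℕ) (hj : j + 1 ≤ n) :
    (∀ (σ : K →+* ℝ) (u : EuclideanSpace ℝ (Fin (n + 1))), u ≠ 0 →
      SchmidtApprox.unifExponent σ 1 j u ≤ SchmidtApprox.ordExponent σ 1 j u ∧
      (((((j : ℝ) + 1) / ((n : ℝ) - (j : ℝ)) : ℝ)) : EReal) ≤
        SchmidtApprox.unifExponent σ 1 j u) ∧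
    (∀ (σ : K →+* ℂ) (u : EuclideanSpace ℂ (Fin (n + 1))),
      ¬ NumberField.ComplexEmbedding.IsReal σ → u ≠ 0 →
      SchmidtApprox.unifExponent σ 2 j u ≤ SchmidtApprox.ordExponent σ 2 j u ∧
      (((((j : ℝ) + 1) / ((n : ℝ) - (j : ℝ)) : ℝ)) : EReal) ≤
        SchmidtApprox.unifExponent σ 2 j u) := by
  classical
  refine ⟨fun σ u hu => ⟨SchmidtApprox.unifExponent_le_ordExponent σ 1 j u, ?_⟩,
    fun σ u hσ hu => ⟨SchmidtApprox.unifExponent_le_ordExponent σ 2 j u, ?_⟩⟩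
  · have hconj : NumberField.ComplexEmbedding.conjugate (Complex.ofRealHom.comp σ) =
        Complex.ofRealHom.comp σ := by
      ext x
      exact Complex.conj_ofReal _
    exact SchmidtApprox.le_unifExponent σ Complex.ofRealHom (fun z => Complex.norm_real z)
      (fun _ z => Complex.conj_ofReal z) hj hu (by rw [hconj]; simp)
  · have hne : σ ≠ NumberField.ComplexEmbedding.conjugate σ := fun h =>
      hσ (NumberField.ComplexEmbedding.isReal_iff.mpr h.symm)
    exact SchmidtApprox.le_unifExponent σ (RingHom.id ℂ) (fun z => rfl)
      (fun h => absurd h.symm hne) hj hu (Finset.card_pair hne)
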